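/- **Theorem.** Let $F:(M_1^n,g_1)\to(M_2^m,g_2)$ be a Riemannian submersion between smooth Riemannian manifolds (a surjective smooth map whose differential is onto at every point and preserves the length of horizontal vectors), let $p\in M_1$, let $\mathcal V_p=\ker F_{*p}$ and $\mathcal H_p=\mathcal V_p^{\perp}$, and suppose that $r=\dim\mathcal V_p>2$. Write $h$ and $v$ for the orthogonal projections onto $(\ker F_*)^\perp$ and $\ker F_*$, $\nabla$ for the Levi-Civita connection of $g_1$, $\mathcal T_EG=h\nabla_{vE}vG+v\nabla_{vE}hG$ for O'Neill's tensor, and $\hat\nabla_UW=v\nabla_UW$ for the Levi-Civita connection of the fibres on vertical vector fields. Let $R^{M_1}$ and $R^{\ker F_*}$ be the curvature tensors of $\nabla$ and $\hat\nabla$, with the sign convention $$R(X,Y,Z,W)=g_1\big(R(X,Y)W,Z\big),\qquad R(X,Y)W=\nabla_X\nabla_YW-\nabla_Y\nabla_XW-\nabla_{[X,Y]}W$$ (and likewise with $\hat\nabla$), that is, the convention for which the Gauss equation reads $R^{M_1}(X,Y,Z,W)=R^{\ker F_*}(X,Y,Z,W)+g_1(\mathcal T_XW,\mathcal T_YZ)-g_1(\mathcal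 T_YW,\mathcal T_XZ)$ on vertical vectors; with it, $R(V_1,V_2,V_2,V_1)$ is minus the sectional curvature of the plane spanned by orthonormal $V_1,V_2$. Let $\Pi\subset\mathcal V_p$ be a $2$-plane, let $\{V_1,\dots,V_r\}$ be an orthonormal basis of $\mathcal V_p$ with $\Pi=\mathrm{span}\{V_1,V_2\}$, and put, for $R=R^{\ker F_*}$ and $R=R^{M_1}$ respectively, $$\tau_{\mathcal V}(p)=\tfrac12\sum_{i,j=1}^rR(V_i,V_j,V_j,V_i),\qquad K_{\mathcal V}(\Pi)=R(V_1,V_2,V_2,V_1),\qquad H=\tfrac1r\sum_{i=1}^r\mathcal T_{V_i}V_i .$$ Then $$\tau_{\mathcal V}^{\ker F_*}(p)-K_{\mathcal V}^{\ker F_*}(\Pi)\;\ge\;\tau_{\mathcal V}^{M_1}(p)-K_{\mathcal V}^{M_1}(\Pi)-\frac{r^2(r-2)}{2(r-1)}\,\|H\|^2 .$$ Let moreover $\{h_1,\dots,h_s\}$, $s=m$, be an orthonormal basis of $\mathcal H_p$ with $H$ a multiple of $h_1$ (bases $\{V_i\}$, $\{h_\ell\}$ as required always exist), and put $(\mathcal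 T^{\mathcal H})^\ell_{ij}=g_1(\mathcal T_{V_i}V_j,h_\ell)$. Equality holds if and only if $$\begin{aligned} (\mathcal T^{\mathcal H})^\ell_{1j}=(\mathcal T^{\mathcal H})^\ell_{2j}&=0 &&(j>2,\ \ell=1,\dots,s),\\ (\mathcal T^{\mathcal H})^1_{ij}&=0 &&(i\ne j,\ i,j>2),\\ (\mathcal T^{\mathcal H})^\ell_{ij}&=0 &&(i,j>2,\ \ell=2,\dots,s),\\ (\mathcal T^{\mathcal H})^\ell_{11}+(\mathcal T^{\mathcal H})^\ell_{22}&=0 &&(\ell=2,\dots,s),\\ (\mathcal T^{\mathcal H})^1_{11}+(\mathcal T^{\mathcal H})^1_{22}&=(\mathcal T^{\mathcal H})^1_{33}=\dots=(\mathcal T^{\mathcal H})^1_{rr}. \end{aligned}$$ Moreover, the orthonormal basis $\{V_1,V_2\}$ of $\Pi$ can be replaced (keeping $V_3,\dots,V_r$ and $h_1,\dots,h_s$) by one for which $(\mathcal T^{\mathcal H})^1_{12}=(\mathcal T^{\mathcal H})^1_{21}=0$. If $s=0$, conditions that mention $h_1$ are void. -/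

import Mathlib

open Bundle Manifold
open scoped ContDiff

set_option linter.unusedSectionVars false

noncomputable section

namespace SubmersionGeometry

section LeviCivita

variable
  {E : Type*} [NormedAddCommGroup E] [NormedSpace ℝ E] [FiniteDimensional ℝ E] [CompleteSpace E]
  {H : Type*} [TopologicalSpace H] (I : ModelWithCorners ℝ E H)
  {M : Type*} [TopologicalSpace M] [ChartedSpace H M] [IsManifold I ∞ M]
  [RiemannianBundle (fun x : M => TangentSpace I x)]

/-- The right-hand side of the Koszul formula for `g(∇_X Y, W)` at the point `x`. -/
def koszul (X Y W : Π x : M, TangentSpace I x) (x : M) : ℝ :=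
  (1 / 2 : ℝ) *
    (mvfderiv I (fun y => inner ℝ (Y y) (W y)) x (X x)
      + mvfderiv I (fun y => inner ℝ (X y) (W y)) x (Y x)
      - mvfderiv I (fun y => inner ℝ (X y) (Y y)) x (W x)
      + inner ℝ (VectorField.mlieBracket I X Y x) (W x)
      - inner ℝ (VectorField.mlieBracket I X W x) (Y x)
      - inner ℝ (VectorField.mlieBracket I Y W x) (X x))

variable [IsContMDiffRiemannianBundle I ∞ E (fun x : M => TangentSpace I x)]

variable {I}

theorem mdifferentiableAt_inner {σ τ : Π x : M, TangentSpace I x} {x : M}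
    (hσ : MDiffAt (T% σ) x) (hτ : MDiffAt (T% τ) x) :
    MDiffAt (fun y => (inner ℝ (σ y) (τ y) : ℝ)) x :=
  MDifferentiableAt.inner_bundle (IB := I) (F := E) (E := fun x : M => TangentSpace I x)
    (b := fun y => y) hσ hτ

theorem mvfderiv_inner_smul {f : M → ℝ} {σ τ : Π x : M, TangentSpace I x} {x : M}
    (hf : MDiffAt f x) (hσ : MDiffAt (T% σ) x) (hτ : MDiffAt (T% τ) x) (v : TangentSpace I x) :
    mvfderiv I (fun y => inner ℝ ((f • σ) y) (τ y)) x v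
      = f x * mvfderiv I (fun y => inner ℝ (σ y) (τ y)) x v
        + inner ℝ (σ x) (τ x) * mvfderiv I f x v := by
  simp only [Pi.smul_apply', real_inner_smul_left]
  rw [mvfderiv_fun_mul hf (mdifferentiableAt_inner hσ hτ)]
  simp

theorem mvfderiv_inner_add {σ σ' τ : Π x : M, TangentSpace I x} {x : M}
    (hσ : MDiffAt (T% σ) x) (hσ' : MDiffAt (T% σ') x) (hτ : MDiffAt (T% τ) x)
    (v : TangentSpace I x) :
    mvfderiv I (fun y => inner ℝ ((σ + σ') y) (τ y)) x v
      = mvfderiv I (fun y => inner ℝ (σ y) (τ y)) x v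
        + mvfderiv I (fun y => inner ℝ (σ' y) (τ y)) x v := by
  simp only [Pi.add_apply, inner_add_left]
  rw [mvfderiv_fun_add (mdifferentiableAt_inner hσ hτ) (mdifferentiableAt_inner hσ' hτ)]
  simp

theorem mvfderiv_inner_comm (σ τ : Π x : M, TangentSpace I x) (x : M) :
    mvfderiv I (fun y => (inner ℝ (σ y) (τ y) : ℝ)) x
      = mvfderiv I (fun y => (inner ℝ (τ y) (σ y) : ℝ)) x := by
  congr 1
  funext y
  exact real_inner_comm _ _

theorem koszul_tensorial_left {Y W : Π x : M, TangentSpace I x} {x : M}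
    (hY : MDiffAt (T% Y) x) (hW : MDiffAt (T% W) x) :
    TensorialAt I E (fun X : Π x : M, TangentSpace I x => koszul I X Y W x) x where
  smul {f σ} hf hX := by
    have h2 : IsManifold I 2 M := inferInstance
    simp only [koszul, VectorField.mlieBracket_smul_left (W := Y) hf hX,
      VectorField.mlieBracket_smul_left (W := W) hf hX,
      mvfderiv_inner_smul hf hX hW, mvfderiv_inner_smul hf hX hY]
    simp only [Pi.smul_apply', map_smul, smul_eq_mul, inner_add_left, real_inner_smul_left,
      real_inner_smul_right]
    ring
  add {σ σ'} hX hX' := by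
    have h2 : IsManifold I 2 M := inferInstance
    simp only [koszul, VectorField.mlieBracket_add_left (W := Y) hX hX',
      VectorField.mlieBracket_add_left (W := W) hX hX',
      mvfderiv_inner_add hX hX' hW, mvfderiv_inner_add hX hX' hY]
    simp only [Pi.add_apply, map_add, inner_add_left, inner_add_right]
    ring

theorem koszul_tensorial_right {X Y : Π x : M, TangentSpace I x} {x : M}
    (hX : MDiffAt (T% X) x) (hY : MDiffAt (T% Y) x) :
    TensorialAt I E (fun W : Π x : M, TangentSpace I x => koszul I X Y W x) x where
  smul {f σ} hf hW := by
    have h2 : IsManifold I 2 M := inferInstance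
    simp only [koszul, VectorField.mlieBracket_smul_right (V := X) hf hW,
      VectorField.mlieBracket_smul_right (V := Y) hf hW,
      mvfderiv_inner_comm X (f • σ), mvfderiv_inner_comm Y (f • σ),
      mvfderiv_inner_smul hf hW hX, mvfderiv_inner_smul hf hW hY,
      mvfderiv_inner_comm X σ, mvfderiv_inner_comm Y σ]
    simp only [Pi.smul_apply', map_smul, smul_eq_mul, inner_add_left, real_inner_smul_left,
      real_inner_smul_right]
    ring
  add {σ σ'} hW hW' := by
    have h2 : IsManifold I 2 M := inferInstance
    simp only [koszul, VectorField.mlieBracket_add_right (V := X) hW hW',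
      VectorField.mlieBracket_add_right (V := Y) hW hW',
      mvfderiv_inner_comm X (σ + σ'), mvfderiv_inner_comm Y (σ + σ'),
      mvfderiv_inner_add hW hW' hX, mvfderiv_inner_add hW hW' hY,
      mvfderiv_inner_comm X σ, mvfderiv_inner_comm Y σ,
      mvfderiv_inner_comm X σ', mvfderiv_inner_comm Y σ']
    simp only [Pi.add_apply, map_add, inner_add_left, inner_add_right]
    ring

open Classical in
/-- The Koszul form `(u, w) ↦ g(∇_u Y, w)` of a vector field `Y` at a point where `Y` is
differentiable (and `0` elsewhere). -/
def koszulForm (Y : Π x : M, TangentSpace I x) (x : M) :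
    TangentSpace I x →L[ℝ] TangentSpace I x →L[ℝ] ℝ :=
  if hY : MDiffAt (T% Y) x then
    TensorialAt.mkHom₂ (fun X W => koszul I X Y W x) x
      (fun _ hW => koszul_tensorial_left hY hW) (fun _ hX => koszul_tensorial_right hX hY)
  else 0

theorem koszulForm_apply {X Y W : Π x : M, TangentSpace I x} {x : M}
    (hX : MDiffAt (T% X) x) (hY : MDiffAt (T% Y) x) (hW : MDiffAt (T% W) x) :
    koszulForm Y x (X x) (W x) = koszul I X Y W x := by
  rw [koszulForm, dif_pos hY]
  exact TensorialAt.mkHom₂_apply _ _ hX hW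

instance (x : M) : FiniteDimensional ℝ (TangentSpace I x) :=
  inferInstanceAs (FiniteDimensional ℝ E)

/-- `∇Y` at `x`: the endomorphism of the tangent space representing the Koszul form. -/
def leviCivitaFun (Y : Π x : M, TangentSpace I x) (x : M) :
    TangentSpace I x →L[ℝ] TangentSpace I x :=
  have : CompleteSpace (TangentSpace I x) := FiniteDimensional.complete ℝ _
  LinearMap.toContinuousLinearMap
    { toFun := fun u => (InnerProductSpace.toDual ℝ (TangentSpace I x)).symm (koszulForm Y x u)
      map_add' := fun u v => by simp
      map_smul' := fun c u => by simp }

theorem inner_leviCivitaFun (Y : Π x : M, TangentSpace I x) (x : M) (u w : TangentSpace I x) :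
    inner ℝ (leviCivitaFun Y x u) w = koszulForm Y x u w := by
  have : CompleteSpace (TangentSpace I x) := FiniteDimensional.complete ℝ _
  exact InnerProductSpace.toDual_symm_apply (𝕜 := ℝ) (E := TangentSpace I x)

theorem inner_leviCivitaFun_eq_koszul {X Y W : Π x : M, TangentSpace I x} {x : M}
    (hX : MDiffAt (T% X) x) (hY : MDiffAt (T% Y) x) (hW : MDiffAt (T% W) x) :
    inner ℝ (leviCivitaFun Y x (X x)) (W x) = koszul I X Y W x := by
  rw [inner_leviCivitaFun, koszulForm_apply hX hY hW]

theorem clm_ext_of_fields {x : M} {A B : TangentSpace I x →L[ℝ] TangentSpace I x}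
    (h : ∀ X W : Π x : M, TangentSpace I x, MDiffAt (T% X) x → MDiffAt (T% W) x →
      inner ℝ (A (X x)) (W x) = inner ℝ (B (X x)) (W x)) : A = B := by
  ext u
  refine ext_inner_right ℝ fun w => ?_
  have := h (FiberBundle.extend E u) (FiberBundle.extend E w)
    (FiberBundle.mdifferentiableAt_extend ..) (FiberBundle.mdifferentiableAt_extend ..)
  simpa using this

variable (I M) in
/-- The Levi-Civita connection of a Riemannian manifold. -/
def leviCivita : CovariantDerivative I E (TangentSpace I : M → Type _) where
  toFun := leviCivitaFun
  isCovariantDerivativeOnUniv :=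
    { add := by
        intro σ σ' x hσ hσ' _
        have h2 : IsManifold I 2 M := inferInstance
        refine clm_ext_of_fields fun X W hX hW => ?_
        have hs : MDiffAt (T% (σ + σ')) x := mdifferentiableAt_add_section hσ hσ'
        simp only [add_apply, inner_add_left]
        rw [inner_leviCivitaFun_eq_koszul hX hs hW, inner_leviCivitaFun_eq_koszul hX hσ hW,
          inner_leviCivitaFun_eq_koszul hX hσ' hW]
        simp only [koszul, VectorField.mlieBracket_add_right (V := X) hσ hσ',
          VectorField.mlieBracket_add_left (W := W) hσ hσ',
          mvfderiv_inner_comm X (σ + σ'), mvfderiv_inner_add hσ hσ' hX,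
          mvfderiv_inner_add hσ hσ' hW, mvfderiv_inner_comm X σ, mvfderiv_inner_comm X σ']
        simp only [Pi.add_apply, map_add, inner_add_left, inner_add_right]
        ring
      leibniz := by
        intro σ f x hσ hf _
        have h2 : IsManifold I 2 M := inferInstance
        refine clm_ext_of_fields fun X W hX hW => ?_
        have hs : MDiffAt (T% (f • σ)) x := hf.smul_section hσ
        simp only [add_apply, smul_apply,
          ContinuousLinearMap.smulRight_apply, inner_add_left, real_inner_smul_left]
        rw [inner_leviCivitaFun_eq_koszul hX hs hW, inner_leviCivitaFun_eq_koszul hX hσ hW]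
        simp only [koszul, VectorField.mlieBracket_smul_right (V := X) hf hσ,
          VectorField.mlieBracket_smul_left (W := W) hf hσ,
          mvfderiv_inner_comm X (f • σ), mvfderiv_inner_smul hf hσ hX,
          mvfderiv_inner_smul hf hσ hW, mvfderiv_inner_comm X σ]
        simp only [Pi.smul_apply', map_smul, smul_eq_mul, inner_add_left, real_inner_smul_left,
          real_inner_smul_right]
        ring }

theorem inner_leviCivita {X Y W : Π x : M, TangentSpace I x} {x : M}
    (hX : MDiffAt (T% X) x) (hY : MDiffAt (T% Y) x) (hW : MDiffAt (T% W) x) :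
    inner ℝ (leviCivita I M Y x (X x)) (W x) = koszul I X Y W x :=
  inner_leviCivitaFun_eq_koszul hX hY hW

/-- The Levi-Civita connection is torsion-free. -/
theorem leviCivita_torsion : (leviCivita I M).torsion = 0 := by
  rw [CovariantDerivative.torsion_eq_zero_iff]
  intro X Y x hX hY
  refine ext_inner_right ℝ fun w => ?_
  have hw := FiberBundle.mdifferentiableAt_extend I E w
  have e1 := inner_leviCivita hX hY hw
  have e2 := inner_leviCivita hY hX hw
  simp only [FiberBundle.extend_apply_self] at e1 e2
  rw [inner_sub_left, e1, e2]
  simp only [koszul, VectorField.mlieBracket_swap_apply (V := Y) (W := X), mvfderiv_inner_comm Y X,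
    inner_neg_left, FiberBundle.extend_apply_self]
  ring

/-- The Levi-Civita connection is compatible with the metric. -/
theorem leviCivita_metric {X Y Z : Π x : M, TangentSpace I x} {x : M}
    (hX : MDiffAt (T% X) x) (hY : MDiffAt (T% Y) x) (hZ : MDiffAt (T% Z) x) :
    mvfderiv I (fun y => (inner ℝ (Y y) (Z y) : ℝ)) x (X x)
      = inner ℝ (leviCivita I M Y x (X x)) (Z x) + inner ℝ (Y x) (leviCivita I M Z x (X x)) := by
  rw [real_inner_comm _ (Y x), inner_leviCivita hX hY hZ, inner_leviCivita hX hZ hY]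
  simp only [koszul, VectorField.mlieBracket_swap_apply (V := Z) (W := Y), mvfderiv_inner_comm Z Y,
    inner_neg_left]
  ring

variable (I M) in
/-- The covariant derivative `∇_X Y` of vector fields for the Levi-Civita connection. -/
def nabla (X Y : Π x : M, TangentSpace I x) : Π x : M, TangentSpace I x :=
  fun x => leviCivita I M Y x (X x)

/-- The curvature operator `R(X, Y) Z = D_X D_Y Z - D_Y D_X Z - D_[X, Y] Z` on vector fields of a
connection `D` (written as `D X Y = D_X Y`). -/
def curvatureOperator
    (D : (Π x : M, TangentSpace I x) → (Π x : M, TangentSpace I x) → Π x : M, TangentSpace I x)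
    (X Y Z : Π x : M, TangentSpace I x) : Π x : M, TangentSpace I x :=
  D X (D Y Z) - D Y (D X Z) - D (VectorField.mlieBracket I X Y) Z

variable (I) in
/-- The Riemannian curvature tensor of type `(0,4)` of the manifold, with the convention
`R(u, v, w, z) = g(R(u, v) z, w)` usual for Riemannian submersions, i.e. the sign for which
`R^M(u, v, w, z) = R^fibre(u, v, w, z) + g(T_u z, T_v w) - g(T_v z, T_u w)` on vertical vectors.
(With this sign `R(u, v, v, u)` is minus the sectional curvature of an orthonormal pair.)
The value at `p` does not depend on how tangent vectors are extended to vector fields. -/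
def riemannTensor (p : M) (u v w z : TangentSpace I p) : ℝ :=
  inner ℝ (curvatureOperator (nabla I M) (FiberBundle.extend E u) (FiberBundle.extend E v)
    (FiberBundle.extend E z) p) w

end LeviCivita

section Submersion

variable
  {E : Type*} [NormedAddCommGroup E] [NormedSpace ℝ E] [FiniteDimensional ℝ E] [CompleteSpace E]
  {H : Type*} [TopologicalSpace H] (I : ModelWithCorners ℝ E H)
  {M : Type*} [TopologicalSpace M] [ChartedSpace H M]
  {E' : Type*} [NormedAddCommGroup E'] [NormedSpace ℝ E']
  {H' : Type*} [TopologicalSpace H'] (J : ModelWithCorners ℝ E' H')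
  {N : Type*} [TopologicalSpace N] [ChartedSpace H' N]
  [RiemannianBundle (fun x : M => TangentSpace I x)]
  (F : M → N)

/-- The vertical space `ker F_{*p}`. -/
def vertical (p : M) : Submodule ℝ (TangentSpace I p) :=
  LinearMap.ker (mfderiv I J F p : TangentSpace I p →ₗ[ℝ] TangentSpace J (F p))

/-- The horizontal space `(ker F_{*p})ᗮ`. -/
def horizontal (p : M) : Submodule ℝ (TangentSpace I p) :=
  (vertical I J F p)ᗮ

/-- A Riemannian submersion: a surjective smooth map whose differential is onto at every point and
preserves the length of horizontal vectors. -/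
structure IsRiemannianSubmersion [RiemannianBundle (fun y : N => TangentSpace J y)] : Prop where
  surjective : Function.Surjective F
  smooth : ContMDiff I J ∞ F
  mfderiv_surjective : ∀ p : M, Function.Surjective (mfderiv I J F p)
  norm_mfderiv : ∀ (p : M) (v : TangentSpace I p), v ∈ horizontal I J F p →
    ‖mfderiv I J F p v‖ = ‖v‖

/-- The vertical part `vX` of a vector field. -/
def vPart (X : Π x : M, TangentSpace I x) : Π x : M, TangentSpace I x :=
  fun x => (vertical I J F x).starProjection (X x)

/-- The horizontal part `hX` of a vector field. -/
def hPart (X : Π x : M, TangentSpace I x) : Π x : M, TangentSpace I x :=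
  fun x => (horizontal I J F x).starProjection (X x)

variable [IsManifold I ∞ M] [IsContMDiffRiemannianBundle I ∞ E (fun x : M => TangentSpace I x)]

/-- O'Neill's tensor `T_X Y = h ∇_{vX} (vY) + v ∇_{vX} (hY)` on vector fields. -/
def oneillT (X Y : Π x : M, TangentSpace I x) : Π x : M, TangentSpace I x :=
  hPart I J F (nabla I M (vPart I J F X) (vPart I J F Y))
    + vPart I J F (nabla I M (vPart I J F X) (hPart I J F Y))

/-- O'Neill's tensor `T` at a point; the value does not depend on the extensions. -/
def oneillTAt (p : M) (u w : TangentSpace I p) : TangentSpace I p :=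
  oneillT I J F (FiberBundle.extend E u) (FiberBundle.extend E w) p

/-- The induced Levi-Civita connection of the fibres, on vertical vector fields: the vertical part
of the ambient Levi-Civita connection. -/
def fibreNabla (X Y : Π x : M, TangentSpace I x) : Π x : M, TangentSpace I x :=
  vPart I J F (nabla I M X Y)

/-- For vertical fields, `fibreNabla` is given by the Koszul formula along the fibres. -/
theorem inner_fibreNabla {X Y W : Π x : M, TangentSpace I x} {x : M}
    (hX : MDiffAt (T% X) x) (hY : MDiffAt (T% Y) x) (hW : MDiffAt (T% W) x)
    (hWx : W x ∈ vertical I J F x) :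
    inner ℝ (fibreNabla I J F X Y x) (W x) = koszul I X Y W x := by
  rw [← inner_leviCivita hX hY hW]
  simp only [fibreNabla, vPart, nabla]
  rw [Submodule.inner_starProjection_left_eq_right, Submodule.starProjection_eq_self_iff.mpr hWx]

/-- The Riemannian curvature tensor of the fibres (i.e. of `ker F_*`), with the same convention
`R(u, v, w, z) = g(R(u, v) z, w)`; `u, v, w, z` are vertical and are extended to vertical vector
fields. -/
def fibreRiemannTensor (p : M) (u v w z : TangentSpace I p) : ℝ :=
  inner ℝ (curvatureOperator (fibreNabla I J F) (vPart I J F (FiberBundle.extend E u))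
    (vPart I J F (FiberBundle.extend E v)) (vPart I J F (FiberBundle.extend E z)) p) w

/-- The component `(T^H)_{ij}^ℓ = g(T(V_i, V_j), h_ℓ)`, for vectors `u = V_i`, `w = V_j`,
`h = h_ℓ`. -/
def tComp (p : M) (u w h : TangentSpace I p) : ℝ :=
  inner ℝ (oneillTAt I J F p u w) h

/-- The mean curvature vector `H = (1/r) ∑ T(V_i, V_i)` of the fibre, in an orthonormal basis `V`
of the vertical space. -/
def meanCurvature (p : M) {r : ℕ} (V : Fin r → TangentSpace I p) : TangentSpace I p :=
  (1 / (r : ℝ)) • ∑ i, oneillTAt I J F p (V i) (V i)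

end Submersion

section Frames

/-- `V` is an orthonormal basis of the subspace `S`. -/
def IsOrthonormalBasisOf {T : Type*} [NormedAddCommGroup T] [InnerProductSpace ℝ T] {k : ℕ}
    (V : Fin k → T) (S : Submodule ℝ T) : Prop :=
  Orthonormal ℝ V ∧ Submodule.span ℝ (Set.range V) = S

/-- The index of `V_1` in `V_1, …, V_r`. -/
def idx1 {r : ℕ} (hr : 2 < r) : Fin r := ⟨0, by omega⟩

/-- The index of `V_2` in `V_1, …, V_r`. -/
def idx2 {r : ℕ} (hr : 2 < r) : Fin r := ⟨1, by omega⟩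

/-- `τ = (1/2) ∑_{i,j} R(V_i, V_j, V_j, V_i)`. -/
def scalarCurvature {T : Type*} (R : T → T → T → T → ℝ) {r : ℕ} (V : Fin r → T) : ℝ :=
  (1 / 2 : ℝ) * ∑ i, ∑ j, R (V i) (V j) (V j) (V i)

/-- `K(Π) = R(V_1, V_2, V_2, V_1)`, where `Π` is spanned by the orthonormal pair `V_1, V_2`. -/
def planeCurvature {T : Type*} (R : T → T → T → T → ℝ) {r : ℕ} (hr : 2 < r) (V : Fin r → T) : ℝ :=
  R (V (idx1 hr)) (V (idx2 hr)) (V (idx2 hr)) (V (idx1 hr))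

variable
  {E : Type*} [NormedAddCommGroup E] [NormedSpace ℝ E] [FiniteDimensional ℝ E] [CompleteSpace E]
  {H : Type*} [TopologicalSpace H] (I : ModelWithCorners ℝ E H)
  {M : Type*} [TopologicalSpace M] [ChartedSpace H M] [IsManifold I ∞ M]
  {E' : Type*} [NormedAddCommGroup E'] [NormedSpace ℝ E']
  {H' : Type*} [TopologicalSpace H'] (J : ModelWithCorners ℝ E' H')
  {N : Type*} [TopologicalSpace N] [ChartedSpace H' N]
  [RiemannianBundle (fun x : M => TangentSpace I x)]
  [IsContMDiffRiemannianBundle I ∞ E (fun x : M => TangentSpace I x)]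
  (F : M → N) (p : M)

/-- `V_1, …, V_r` is an orthonormal basis of the vertical space whose first two vectors span the
plane `P`. -/
def IsVerticalFrame {r : ℕ} (hr : 2 < r) (P : Submodule ℝ (TangentSpace I p))
    (V : Fin r → TangentSpace I p) : Prop :=
  IsOrthonormalBasisOf V (vertical I J F p) ∧
    Submodule.span ℝ {V (idx1 hr), V (idx2 hr)} = P

/-- `h_1, …, h_s` is an orthonormal basis of the horizontal space with `h_1` in the direction of the
mean curvature vector (no condition on `h_1` if that vector is zero). -/
def IsHorizontalFrame {r s : ℕ} (V : Fin r → TangentSpace I p) (h : Fin s → TangentSpace I p) :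
    Prop :=
  IsOrthonormalBasisOf h (horizontal I J F p) ∧
    ∀ l : Fin s, (l : ℕ) ≠ 0 → inner ℝ (meanCurvature I J F p V) (h l) = 0

/-- The conditions on the components of `T^H` characterising equality. Indices start at `0` here:
`2 ≤ i` means that `V i` is one of `V_3, …, V_r`, and `l = 0` means that `h l` is `h_1`. -/
def EqualityConditions {r s : ℕ} (hr : 2 < r) (V : Fin r → TangentSpace I p)
    (h : Fin s → TangentSpace I p) : Prop :=
  (∀ (j : Fin r) (l : Fin s), 2 ≤ (j : ℕ) →
      tComp I J F p (V (idx1 hr)) (V j) (h l) = 0 ∧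
      tComp I J F p (V (idx2 hr)) (V j) (h l) = 0) ∧
  (∀ (i j : Fin r) (l : Fin s), 2 ≤ (i : ℕ) → 2 ≤ (j : ℕ) → i ≠ j → (l : ℕ) = 0 →
      tComp I J F p (V i) (V j) (h l) = 0) ∧
  (∀ (i j : Fin r) (l : Fin s), 2 ≤ (i : ℕ) → 2 ≤ (j : ℕ) → (l : ℕ) ≠ 0 →
      tComp I J F p (V i) (V j) (h l) = 0) ∧
  (∀ l : Fin s, (l : ℕ) ≠ 0 →
      tComp I J F p (V (idx1 hr)) (V (idx1 hr)) (h l)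
        + tComp I J F p (V (idx2 hr)) (V (idx2 hr)) (h l) = 0) ∧
  (∀ (i : Fin r) (l : Fin s), 2 ≤ (i : ℕ) → (l : ℕ) = 0 →
      tComp I J F p (V (idx1 hr)) (V (idx1 hr)) (h l)
        + tComp I J F p (V (idx2 hr)) (V (idx2 hr)) (h l) = tComp I J F p (V i) (V i) (h l))

end Frames

end SubmersionGeometry
end

open SubmersionGeometry

/-! The fibre of `F` through `p` is a submanifold, and on vertical vectors `T` is its second
fundamental form, so the statement is Chen's inequality for that submanifold. Write t^ℓ for the
symmetric matrix (T^H)^ℓ_{ij}. By the Gauss equation (`gauss_equation`), the ambient side τ - K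
minus the fibre side τ - K is the sum over ℓ of ½ Σ_{ij} (t_ii t_jj - t_ij²) - (t_11 t_22 - t_12²).

For one matrix, put s = tr t. Subtracting the plane term removes t_12 and completes the square (t_11
+ t_22)². What remains is ½ s² minus half the sum of squares of the r - 1 numbers t_11 + t_22, t_33,
..., t_rr, minus squares of the other off-diagonal entries. These r - 1 numbers add up to s, so
their squares sum to s²/(r - 1) plus the squared deviations from the mean. Hence the expression is
(r - 2)/(2(r - 1)) s² minus a nonnegative defect (`chen_identity`). Summing over ℓ and using Σ_ℓ (tr
t^ℓ)² = r²‖H‖² gives an exact formula (`chen_difference`). Equality means that every defect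
vanishes. Since tr t^ℓ = r g(H, h_ℓ) is zero for ℓ ≠ 1, this is the stated list.

The analytic work is the Gauss equation. The two curvature tensors use different extensions of the
vectors: arbitrary ones for the ambient manifold, vertical ones for the fibres. So the ambient
curvature must be shown independent of the extension (`curvature_congr`), vertical and horizontal
parts of smooth fields must be smooth (`smooth_hPart`), and brackets of vertical fields must be
vertical. -/

noncomputable section

namespace SubmersionGeometry

open VectorField Topology

/-! ### Smooth functions and fields at a point; the bracket as a commutator of derivations. -/

section Smoothness

variable
  {E : Type*} [NormedAddCommGroup E] [NormedSpace ℝ E] [FiniteDimensional ℝ E] [CompleteSpace E]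
  {H : Type*} [TopologicalSpace H] {I : ModelWithCorners ℝ E H}
  {M : Type*} [TopologicalSpace M] [ChartedSpace H M] [IsManifold I ∞ M]

theorem contMDiffAt_mvfderiv_apply {f : M → ℝ} {V : Π x : M, TangentSpace I x} {x : M}
    (hf : CMDiffAt ∞ f x) (hV : CMDiffAt ∞ (T% V) x) :
    CMDiffAt ∞ (fun y => mvfderiv I f y (V y)) x := by
  have h1 : IsManifold I 1 M := IsManifold.of_le (n := ∞) (by norm_num)
  have h := ContMDiffAt.mfderiv_const (m := ∞) hf (by simp)
  have h2 := ContMDiffAt.clm_apply_of_inCoordinates (b₁ := id) (v := V) h hV hf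
  rw [contMDiffAt_totalSpace] at h2
  exact h2.2.congr_of_eventuallyEq (Filter.Eventually.of_forall fun y => by simp [mvfderiv]; rfl)

theorem smooth_mdiffAt {V : Π x : M, TangentSpace I x} {x : M}
    (hV : CMDiffAt ∞ (T% V) x) : MDiffAt (T% V) x :=
  hV.mdifferentiableAt (by simp)

theorem smooth_eventually_mdiffAt {V : Π x : M, TangentSpace I x} {x : M}
    (hV : CMDiffAt ∞ (T% V) x) : ∀ᶠ y in 𝓝 x, MDiffAt (T% V) y := by
  have h1 : IsManifold I 1 M := IsManifold.of_le (n := ∞) (by norm_num)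
  have h2 : IsManifold (I.prod 𝓘(ℝ, E)) 1 (TangentBundle I M) := inferInstance
  -- Order ∞ at a point need not spread to a neighbourhood, since the neighbourhood may shrink with
  -- the order; order 1 does spread.
  filter_upwards [(contMDiffAt_iff_contMDiffAt_nhds (n := 1) (by simp)).mp
    (hV.of_le (by exact_mod_cast le_top))] with y hy
  exact hy.mdifferentiableAt (by simp)

theorem smooth_eventually_mdiffAt_fun {f : M → ℝ} {x : M}
    (hV : CMDiffAt ∞ f x) : ∀ᶠ y in 𝓝 x, MDiffAt f y := by
  have h1 : IsManifold I 1 M := IsManifold.of_le (n := ∞) (by norm_num)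
  filter_upwards [(contMDiffAt_iff_contMDiffAt_nhds (n := 1) (by simp)).mp
    (hV.of_le (by exact_mod_cast le_top))] with y hy
  exact hy.mdifferentiableAt (by simp)

theorem smooth_mlieBracket {U V : Π x : M, TangentSpace I x} {x : M}
    (hU : CMDiffAt ∞ (T% U) x) (hV : CMDiffAt ∞ (T% V) x) :
    CMDiffAt ∞ (T% (mlieBracket I U V)) x := by
  have h2 : IsManifold I (minSmoothness ℝ 2) M :=
    IsManifold.of_le (n := ∞) (by simpa using ENat.LEInfty.out)
  have h1 : IsManifold I ((⊤:ℕ∞) + 1) M := by simpa using (inferInstance : IsManifold I ∞ M)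
  exact ContMDiffAt.mlieBracket_vectorField (m := ⊤) (n := ⊤) hU hV (by simp)

/-- The Lie bracket acts on functions as the commutator. -/
theorem mvfderiv_mlieBracket {f : M → ℝ} {U V : Π x : M, TangentSpace I x} {x : M}
    (hf : CMDiffAt ∞ f x) (hU : CMDiffAt ∞ (T% U) x) (hV : CMDiffAt ∞ (T% V) x) :
    mvfderiv I f x (mlieBracket I U V x)
      = mvfderiv I (fun y => mvfderiv I f y (V y)) x (U x)
        - mvfderiv I (fun y => mvfderiv I f y (U y)) x (V x) := by
  have h2 : IsManifold I 2 M := IsManifold.of_le (n := ∞) ENat.LEInfty.out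
  have h3 : IsManifold I (minSmoothness ℝ 3) M :=
    IsManifold.of_le (n := ∞) (by simpa using ENat.LEInfty.out)
  -- The argument below reads off the coefficient of a nonzero vector, so dimension zero is treated
  -- separately.
  rcases subsingleton_or_nontrivial E with hE | hE
  · have : Subsingleton (TangentSpace I x) := hE
    rw [Subsingleton.elim (mlieBracket I U V x) 0, Subsingleton.elim (U x) 0,
      Subsingleton.elim (V x) 0]
    simp
  obtain ⟨w, hw⟩ : ∃ w : TangentSpace I x, w ≠ 0 := exists_ne (α := E) 0
  set W : Π x : M, TangentSpace I x := FiberBundle.extend E w with hWdef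
  have hW : CMDiffAt ∞ (T% W) x := FiberBundle.contMDiffAt_extend ..
  have le2 : minSmoothness ℝ 2 ≤ (∞ : WithTop ℕ∞) := by simpa using ENat.LEInfty.out
  -- Expand the Jacobi identity for `U`, `V`, `f • W` and subtract `f` times the one for `U`, `V`,
  -- `W`. The first-order terms in `f` cancel, leaving the commutator identity multiplied by `W x`,
  -- which is nonzero.
  have jac := leibniz_identity_mlieBracket_apply (hU.of_le le2) (hV.of_le le2)
    ((hf.smul_section hW).of_le le2)
  have jac0 := leibniz_identity_mlieBracket_apply (hU.of_le le2) (hV.of_le le2) (hW.of_le le2)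
  have br : ∀ {A : Π x : M, TangentSpace I x}, CMDiffAt ∞ (T% A) x →
      mlieBracket I A (f • W) =ᶠ[𝓝 x]
        (fun y => mvfderiv I f y (A y)) • W + f • mlieBracket I A W := by
    intro A hA
    filter_upwards [smooth_eventually_mdiffAt hW, smooth_eventually_mdiffAt_fun hf] with y hy hfy
    exact mlieBracket_smul_right hfy hy
  have outer : ∀ {A B : Π x : M, TangentSpace I x}, CMDiffAt ∞ (T% A) x → CMDiffAt ∞ (T% B) x →
      mlieBracket I B (mlieBracket I A (f • W)) x
        = (mvfderiv I (fun y => mvfderiv I f y (A y)) x (B x)) • W x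
          + (mvfderiv I f x (A x)) • mlieBracket I B W x
          + ((mvfderiv I f x (B x)) • mlieBracket I A W x
          + f x • mlieBracket I B (mlieBracket I A W) x) := by
    intro A B hA hB
    rw [Filter.EventuallyEq.mlieBracket_vectorField_eq (Filter.EventuallyEq.refl _ B) (br hA)]
    have sA := contMDiffAt_mvfderiv_apply hf hA
    have sAW := smooth_mlieBracket hA hW
    rw [mlieBracket_add_right (smooth_mdiffAt (sA.smul_section hW))
      (smooth_mdiffAt (hf.smul_section sAW)),
      mlieBracket_smul_right (sA.mdifferentiableAt (by simp)) (smooth_mdiffAt hW),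
      mlieBracket_smul_right (hf.mdifferentiableAt (by simp)) (smooth_mdiffAt sAW)]
  rw [outer hV hU, outer hU hV,
    mlieBracket_smul_right (hf.mdifferentiableAt (by simp)) (smooth_mdiffAt hW), jac0] at jac
  have hWx : W x = w := by simp [hWdef]
  have key : (mvfderiv I f x (mlieBracket I U V x)
      - (mvfderiv I (fun y => mvfderiv I f y (V y)) x (U x)
        - mvfderiv I (fun y => mvfderiv I f y (U y)) x (V x))) • w = 0 := by
    rw [← hWx]
    refine Eq.trans ?_ (sub_eq_zero.mpr jac.symm)
    module
  have := (smul_eq_zero.mp key).resolve_right hw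
  linarith

variable [RiemannianBundle (fun x : M => TangentSpace I x)]
  [IsContMDiffRiemannianBundle I ∞ E (fun x : M => TangentSpace I x)]

theorem smooth_inner {σ τ : Π x : M, TangentSpace I x} {x : M}
    (hσ : CMDiffAt ∞ (T% σ) x) (hτ : CMDiffAt ∞ (T% τ) x) :
    CMDiffAt ∞ (fun y => (inner ℝ (σ y) (τ y) : ℝ)) x :=
  ContMDiffAt.inner_bundle (IB := I) (F := E) (E := fun x : M => TangentSpace I x)
    (b := fun y => y) hσ hτ

theorem contMDiffAt_det {ι : Type*} [Fintype ι] [DecidableEq ι] {G : M → Matrix ι ι ℝ} {x : M}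
    (hG : ∀ i j, CMDiffAt ∞ (fun y => G y i j) x) : CMDiffAt ∞ (fun y => (G y).det) x := by
  simp only [Matrix.det_apply]
  refine contMDiffAt_finsetSum fun σ _ => ?_
  simp only [Units.smul_def, zsmul_eq_mul]
  exact contMDiffAt_const.mul (contMDiffAt_finsetProd fun i _ => hG _ _)

theorem contMDiffAt_inv_entry {ι : Type*} [Fintype ι] [DecidableEq ι] {G : M → Matrix ι ι ℝ} {x : M}
    (hG : ∀ i j, CMDiffAt ∞ (fun y => G y i j) x) (hdet : (G x).det ≠ 0) (i j : ι) :
    CMDiffAt ∞ (fun y => (G y)⁻¹ i j) x := by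
  simp only [Matrix.inv_def, Ring.inverse_eq_inv', Matrix.smul_apply, smul_eq_mul,
    Matrix.adjugate_apply]
  refine ContMDiffAt.mul ?_ ?_
  · exact (contMDiffAt_det hG).inv₀ hdet
  · refine contMDiffAt_det fun k l => ?_
    simp only [Matrix.updateRow_apply]
    split_ifs
    · exact contMDiffAt_const
    · exact hG _ _

/-- A section spanned by a smooth linearly independent family is smooth as soon as its inner
products with the family are. -/
theorem smooth_of_inner_smooth {ι : Type*} [Fintype ι] {e : ι → Π x : M, TangentSpace I x}
    {σ : Π x : M, TangentSpace I x} {x : M}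
    (he : ∀ i, CMDiffAt ∞ (T% (e i)) x) (hli : LinearIndependent ℝ fun i => e i x)
    (hspan : ∀ᶠ y in 𝓝 x, σ y ∈ Submodule.span ℝ (Set.range fun i => e i y))
    (hσ : ∀ i, CMDiffAt ∞ (fun y => (inner ℝ (σ y) (e i y) : ℝ)) x) :
    CMDiffAt ∞ (T% σ) x := by
  classical
  -- The coefficients of `σ` are its inner products with the family times the inverse Gram matrix.
  -- Independence at `x` makes the determinant nonzero there, hence nearby.
  let G : M → Matrix ι ι ℝ := fun y => Matrix.gram ℝ fun i => e i y
  have hG : ∀ i j, CMDiffAt ∞ (fun y => G y i j) x := fun i j => smooth_inner (he i) (he j)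
  have hdet : (G x).det ≠ 0 := Matrix.det_gram_ne_zero_iff_linearIndependent.mpr hli
  have hsm : CMDiffAt ∞ (T% (fun y => ∑ i, (∑ j, inner ℝ (σ y) (e j y) * (G y)⁻¹ j i) • e i y)) x := by
    refine ContMDiffAt.sum_section fun i _ => ?_
    refine ContMDiffAt.smul_section ?_ (he i)
    exact contMDiffAt_finsetSum fun j _ => (hσ j).mul (contMDiffAt_inv_entry hG hdet j i)
  refine hsm.congr_of_eventuallyEq ?_
  have hev : ∀ᶠ y in 𝓝 x, (G y).det ≠ 0 := (contMDiffAt_det hG).continuousAt.eventually_ne hdet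
  filter_upwards [hspan, hev] with y hy hd
  obtain ⟨c, hc⟩ := (Submodule.mem_span_range_iff_exists_fun ℝ).mp hy
  have hc' : (fun j => (inner ℝ (σ y) (e j y) : ℝ)) = Matrix.vecMul c (G y) := by
    funext j
    rw [← hc, sum_inner]
    simp [Matrix.vecMul, dotProduct, G, Matrix.gram_apply, real_inner_smul_left]
  have : (fun i => ∑ j, inner ℝ (σ y) (e j y) * (G y)⁻¹ j i) = c := by
    change Matrix.vecMul (fun j => (inner ℝ (σ y) (e j y) : ℝ)) (G y)⁻¹ = c
    rw [hc', Matrix.vecMul_vecMul, Matrix.mul_nonsing_inv _ (isUnit_iff_ne_zero.mpr hd),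
      Matrix.vecMul_one]
  have h2 : (∑ i, (∑ j, inner ℝ (σ y) (e j y) * (G y)⁻¹ j i) • e i y) = σ y := by
    rw [← hc]
    exact Finset.sum_congr rfl fun i _ => by rw [← congrFun this i, hc]
  rw [h2]

end Smoothness

/-! ### Function-linear maps depend only on the value at the point. -/

section Tensoriality

variable
  {E : Type*} [NormedAddCommGroup E] [NormedSpace ℝ E] [FiniteDimensional ℝ E] [CompleteSpace E]
  {H : Type*} [TopologicalSpace H] {I : ModelWithCorners ℝ E H}
  {M : Type*} [TopologicalSpace M] [ChartedSpace H M] [IsManifold I ∞ M]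

/-- A map on vector fields that is linear over smooth functions, on smooth fields, depends only on
the value of the field at the point. -/
theorem eq_of_smooth_tensorial {A : Type*} [AddCommGroup A] [Module ℝ A]
    {Φ : (Π x : M, TangentSpace I x) → A} {x : M}
    (hsmul : ∀ {f : M → ℝ} {σ : Π x : M, TangentSpace I x}, CMDiffAt ∞ f x → CMDiffAt ∞ (T% σ) x →
      Φ (f • σ) = f x • Φ σ)
    (hadd : ∀ {σ σ' : Π x : M, TangentSpace I x}, CMDiffAt ∞ (T% σ) x → CMDiffAt ∞ (T% σ') x →
      Φ (σ + σ') = Φ σ + Φ σ')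
    {σ σ' : Π x : M, TangentSpace I x} (hσ : CMDiffAt ∞ (T% σ) x) (hσ' : CMDiffAt ∞ (T% σ') x)
    (hσσ' : σ x = σ' x) : Φ σ = Φ σ' := by
  classical
  have hlocal : ∀ {τ τ' : Π x : M, TangentSpace I x}, CMDiffAt ∞ (T% τ) x →
      CMDiffAt ∞ (T% τ') x → (∀ᶠ y in 𝓝 x, τ y = τ' y) → Φ τ = Φ τ' := by
    intro τ τ' hτ hτ' hev
    -- Smoothness is asked only at `x`, so an indicator function serves as the cut-off: it is 1 near
    -- `x`.
    let ψ : M → ℝ := fun y => if τ y = τ' y then 1 else 0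
    have hψx : ψ x = 1 := by simp [ψ, hev.self_of_nhds]
    have heq : ψ • τ = ψ • τ' := by
      funext y
      by_cases hy : τ y = τ' y <;> simp [ψ, hy]
    have hψ : CMDiffAt ∞ ψ x :=
      (contMDiffAt_const (c := (1 : ℝ))).congr_of_eventuallyEq
        (hev.mono fun y hy => by simp [ψ, hy])
    calc Φ τ = Φ (ψ • τ) := by rw [hsmul hψ hτ, hψx, one_smul]
      _ = Φ (ψ • τ') := by rw [heq]
      _ = Φ τ' := by rw [hsmul hψ hτ', hψx, one_smul]
  have hzero : Φ 0 = 0 := by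
    have h0 : CMDiffAt ∞ (T% (0 : Π x : M, TangentSpace I x)) x :=
      (contMDiff_zeroSection ℝ (TangentSpace I : M → Type _)).contMDiffAt
    have := hadd h0 h0
    simpa using this
  have hsum : ∀ {ι : Type _} (s : Finset ι) (τ : ι → Π x : M, TangentSpace I x),
      (∀ i, CMDiffAt ∞ (T% (τ i)) x) → Φ (fun y => ∑ i ∈ s, τ i y) = ∑ i ∈ s, Φ (τ i) := by
    intro ι s τ hτ
    induction s using Finset.induction_on with
    | empty => exact hzero
    | insert a s ha ih =>
      simp only [Finset.sum_insert ha, ← ih]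
      exact hadd (hτ a) (ContMDiffAt.sum_section fun i _ => hτ i)
  let t := trivializationAt E (TangentSpace I : M → Type _) x
  have hx : x ∈ t.baseSet := FiberBundle.mem_baseSet_trivializationAt E _ x
  let b := Module.finBasis ℝ E
  have hs : ∀ i, CMDiffAt ∞ (T% (t.localFrame b i)) x :=
    fun i => contMDiffAt_localFrame_of_mem ∞ _ b i hx
  have key : ∀ {τ : Π x : M, TangentSpace I x}, CMDiffAt ∞ (T% τ) x →
      Φ τ = ∑ i, t.localFrameCoeff I b i x (τ x) • Φ (t.localFrame b i) := by
    intro τ hτ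
    have hc : ∀ i, CMDiffAt ∞ (LinearMap.piApply (t.localFrameCoeff I b i) τ) x :=
      fun i => contMDiffAt_localFrameCoeff b hx hτ i
    rw [hlocal (τ' := fun y => ∑ i, (LinearMap.piApply (t.localFrameCoeff I b i) τ • t.localFrame b i) y)
      hτ (ContMDiffAt.sum_section fun i _ => (hc i).smul_section (hs i))
      (t.eventually_eq_localFrame_sum_coeff_smul b hx),
      hsum Finset.univ _ fun i => (hc i).smul_section (hs i)]
    exact Finset.sum_congr rfl fun i _ => hsmul (hc i) (hs i)
  rw [key hσ, key hσ', hσσ']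

end Tensoriality

/-! ### The ambient curvature is a tensor. -/

section Connection

variable
  {E : Type*} [NormedAddCommGroup E] [NormedSpace ℝ E] [FiniteDimensional ℝ E] [CompleteSpace E]
  {H : Type*} [TopologicalSpace H] {I : ModelWithCorners ℝ E H}
  {M : Type*} [TopologicalSpace M] [ChartedSpace H M] [IsManifold I ∞ M]
  [RiemannianBundle (fun x : M => TangentSpace I x)]
  [IsContMDiffRiemannianBundle I ∞ E (fun x : M => TangentSpace I x)]

theorem smooth_koszul {X Y W : Π x : M, TangentSpace I x} {x : M}
    (hX : CMDiffAt ∞ (T% X) x) (hY : CMDiffAt ∞ (T% Y) x) (hW : CMDiffAt ∞ (T% W) x) :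
    CMDiffAt ∞ (koszul I X Y W) x := by
  unfold koszul
  refine contMDiffAt_const.mul ?_
  refine ((((ContMDiffAt.add ?_ ?_).sub ?_).add ?_).sub ?_).sub ?_
  · exact contMDiffAt_mvfderiv_apply (smooth_inner hY hW) hX
  · exact contMDiffAt_mvfderiv_apply (smooth_inner hX hW) hY
  · exact contMDiffAt_mvfderiv_apply (smooth_inner hX hY) hW
  · exact smooth_inner (smooth_mlieBracket hX hY) hW
  · exact smooth_inner (smooth_mlieBracket hX hW) hY
  · exact smooth_inner (smooth_mlieBracket hY hW) hX

/-- A vector field whose inner products with smooth fields are smooth is smooth. -/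
theorem smooth_of_forall_inner {σ : Π x : M, TangentSpace I x} {x : M}
    (h : ∀ W : Π x : M, TangentSpace I x, CMDiffAt ∞ (T% W) x →
      CMDiffAt ∞ (fun y => (inner ℝ (σ y) (W y) : ℝ)) x) : CMDiffAt ∞ (T% σ) x := by
  let t := trivializationAt E (TangentSpace I : M → Type _) x
  have hx : x ∈ t.baseSet := FiberBundle.mem_baseSet_trivializationAt E _ x
  let b := Module.finBasis ℝ E
  have hs : ∀ i, CMDiffAt ∞ (T% (t.localFrame b i)) x :=
    fun i => contMDiffAt_localFrame_of_mem ∞ _ b i hx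
  have hfr := t.isLocalFrameOn_localFrame_baseSet I ∞ b
  refine smooth_of_inner_smooth hs (hfr.linearIndependent hx) ?_ fun i => h _ (hs i)
  filter_upwards [t.open_baseSet.mem_nhds hx] with y hy
  exact hfr.generating hy trivial

theorem smooth_nabla {X Y : Π x : M, TangentSpace I x} {x : M}
    (hX : CMDiffAt ∞ (T% X) x) (hY : CMDiffAt ∞ (T% Y) x) :
    CMDiffAt ∞ (T% (nabla I M X Y)) x := by
  refine smooth_of_forall_inner fun W hW => (smooth_koszul hX hY hW).congr_of_eventuallyEq ?_
  filter_upwards [smooth_eventually_mdiffAt hX, smooth_eventually_mdiffAt hY,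
    smooth_eventually_mdiffAt hW] with y h1 h2 h3
  exact inner_leviCivita h1 h2 h3

theorem nabla_congr_right {X Y Y' : Π x : M, TangentSpace I x} {x : M}
    (hY : MDiffAt (T% Y) x) (hY' : MDiffAt (T% Y') x) (h : ∀ᶠ y in 𝓝 x, Y y = Y' y) :
    nabla I M X Y x = nabla I M X Y' x := by
  simp only [nabla]
  rw [(leviCivita I M).isCovariantDerivativeOnUniv.congr_of_eventuallyEq hY hY' Filter.univ_mem h]

theorem nabla_add_left (X X' Y : Π x : M, TangentSpace I x) :
    nabla I M (X + X') Y = nabla I M X Y + nabla I M X' Y := by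
  funext x; simp [nabla]

theorem nabla_neg_left (X Y : Π x : M, TangentSpace I x) :
    nabla I M (-X) Y = -nabla I M X Y := by
  funext x; simp [nabla]

theorem nabla_smul_left (f : M → ℝ) (X Y : Π x : M, TangentSpace I x) :
    nabla I M (f • X) Y = f • nabla I M X Y := by
  funext x; simp [nabla]

theorem nabla_add_right (X : Π x : M, TangentSpace I x) {Y Y' : Π x : M, TangentSpace I x} {x : M}
    (hY : MDiffAt (T% Y) x) (hY' : MDiffAt (T% Y') x) :
    nabla I M X (Y + Y') x = nabla I M X Y x + nabla I M X Y' x := by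
  simp only [nabla]
  rw [(leviCivita I M).isCovariantDerivativeOnUniv.add hY hY']
  simp

theorem nabla_smul_right (X : Π x : M, TangentSpace I x) {f : M → ℝ}
    {Y : Π x : M, TangentSpace I x} {x : M} (hf : MDiffAt f x) (hY : MDiffAt (T% Y) x) :
    nabla I M X (f • Y) x = f x • nabla I M X Y x + mvfderiv I f x (X x) • Y x := by
  simp only [nabla]
  rw [(leviCivita I M).isCovariantDerivativeOnUniv.leibniz hY hf]
  simp

theorem curvature_swap (X Y Z : Π x : M, TangentSpace I x) (x : M) :
    curvatureOperator (nabla I M) X Y Z x = -curvatureOperator (nabla I M) Y X Z x := by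
  simp only [curvatureOperator, Pi.sub_apply, mlieBracket_swap (V := X) (W := Y), nabla_neg_left,
    Pi.neg_apply]
  abel

/-- The term `Y f` times `∇_σ Z` produced by differentiating `f • ∇_σ Z` along `Y` cancels against
the one in the bracket of `f • σ` with `Y`. The second slot then follows by antisymmetry. -/
theorem curvature_congr_fst {X X' Y Z : Π x : M, TangentSpace I x} {x : M}
    (hX : CMDiffAt ∞ (T% X) x) (hX' : CMDiffAt ∞ (T% X') x)
    (hZ : CMDiffAt ∞ (T% Z) x) (h : X x = X' x) :
    curvatureOperator (nabla I M) X Y Z x = curvatureOperator (nabla I M) X' Y Z x := by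
  have h2 : IsManifold I 2 M := inferInstance
  refine eq_of_smooth_tensorial (Φ := fun X => curvatureOperator (nabla I M) X Y Z x)
    ?_ ?_ hX hX' h
  · intro f σ hf hσ
    have e1 := nabla_smul_right (X := Y) (hf.mdifferentiableAt (by simp))
      (smooth_mdiffAt (smooth_nabla hσ hZ))
    have e2 : nabla I M (mlieBracket I (f • σ) Y) Z x
        = f x • nabla I M (mlieBracket I σ Y) Z x - mvfderiv I f x (Y x) • nabla I M σ Z x := by
      simp only [nabla, mlieBracket_smul_left (W := Y) (hf.mdifferentiableAt (by simp))
        (smooth_mdiffAt hσ), map_add, map_neg, map_smul, neg_smul]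
      abel
    simp only [curvatureOperator, Pi.sub_apply, nabla_smul_left, e1, e2, Pi.smul_apply']
    module
  · intro σ σ' hσ hσ'
    have e1 := nabla_add_right Y (smooth_mdiffAt (smooth_nabla hσ hZ))
      (smooth_mdiffAt (smooth_nabla hσ' hZ))
    have e2 : nabla I M (mlieBracket I (σ + σ') Y) Z x
        = nabla I M (mlieBracket I σ Y) Z x + nabla I M (mlieBracket I σ' Y) Z x := by
      simp only [nabla, mlieBracket_add_left (W := Y) (smooth_mdiffAt hσ) (smooth_mdiffAt hσ'),
        map_add]
    simp only [curvatureOperator, Pi.sub_apply, nabla_add_left, e1, e2, Pi.add_apply]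
    abel

/-- The mixed first-order terms are symmetric in `X` and `Y`, and the second derivatives X Y f - Y X
f cancel against [X, Y] f by `mvfderiv_mlieBracket`. -/
theorem curvature_congr_trd {X Y Z Z' : Π x : M, TangentSpace I x} {x : M}
    (hX : CMDiffAt ∞ (T% X) x) (hY : CMDiffAt ∞ (T% Y) x)
    (hZ : CMDiffAt ∞ (T% Z) x) (hZ' : CMDiffAt ∞ (T% Z') x) (h : Z x = Z' x) :
    curvatureOperator (nabla I M) X Y Z x = curvatureOperator (nabla I M) X Y Z' x := by
  have h2 : IsManifold I 2 M := inferInstance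
  refine eq_of_smooth_tensorial (Φ := fun Z => curvatureOperator (nabla I M) X Y Z x)
    ?_ ?_ hZ hZ' h
  · intro f σ hf hσ
    have second : ∀ {A B : Π x : M, TangentSpace I x}, CMDiffAt ∞ (T% A) x → CMDiffAt ∞ (T% B) x →
        nabla I M A (nabla I M B (f • σ)) x
          = f x • nabla I M A (nabla I M B σ) x + mvfderiv I f x (A x) • nabla I M B σ x
            + (mvfderiv I f x (B x) • nabla I M A σ x
              + mvfderiv I (fun y => mvfderiv I f y (B y)) x (A x) • σ x) := by
      intro A B hA hB
      have sB := contMDiffAt_mvfderiv_apply hf hB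
      have sBσ := smooth_nabla hB hσ
      have hev : ∀ᶠ y in 𝓝 x, nabla I M B (f • σ) y
          = (f • nabla I M B σ + (fun y => mvfderiv I f y (B y)) • σ) y := by
        filter_upwards [smooth_eventually_mdiffAt hσ, smooth_eventually_mdiffAt_fun hf]
          with y h1 h2
        exact nabla_smul_right B h2 h1
      rw [nabla_congr_right (smooth_mdiffAt (smooth_nabla hB (hf.smul_section hσ)))
        (smooth_mdiffAt ((hf.smul_section sBσ).add_section (sB.smul_section hσ))) hev,
        nabla_add_right A (smooth_mdiffAt (hf.smul_section sBσ))
          (smooth_mdiffAt (sB.smul_section hσ)),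
        nabla_smul_right A (hf.mdifferentiableAt (by simp)) (smooth_mdiffAt sBσ),
        nabla_smul_right A (sB.mdifferentiableAt (by simp)) (smooth_mdiffAt hσ)]
    simp only [curvatureOperator, Pi.sub_apply, second hX hY, second hY hX,
      nabla_smul_right _ (hf.mdifferentiableAt (by simp)) (smooth_mdiffAt hσ),
      mvfderiv_mlieBracket hf hX hY]
    module
  · intro σ σ' hσ hσ'
    have second : ∀ {A B : Π x : M, TangentSpace I x}, CMDiffAt ∞ (T% A) x → CMDiffAt ∞ (T% B) x →
        nabla I M A (nabla I M B (σ + σ')) x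
          = nabla I M A (nabla I M B σ) x + nabla I M A (nabla I M B σ') x := by
      intro A B hA hB
      have hev : ∀ᶠ y in 𝓝 x, nabla I M B (σ + σ') y
          = (nabla I M B σ + nabla I M B σ') y := by
        filter_upwards [smooth_eventually_mdiffAt hσ, smooth_eventually_mdiffAt hσ']
          with y h1 h2
        exact nabla_add_right B h1 h2
      rw [nabla_congr_right (smooth_mdiffAt (smooth_nabla hB (hσ.add_section hσ')))
        (smooth_mdiffAt ((smooth_nabla hB hσ).add_section (smooth_nabla hB hσ'))) hev,
        nabla_add_right A (smooth_mdiffAt (smooth_nabla hB hσ))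
          (smooth_mdiffAt (smooth_nabla hB hσ'))]
    simp only [curvatureOperator, Pi.sub_apply, second hX hY, second hY hX,
      nabla_add_right _ (smooth_mdiffAt hσ) (smooth_mdiffAt hσ')]
    abel

/-- The curvature operator on smooth fields depends only on the values at the point. -/
theorem curvature_congr {X X' Y Y' Z Z' : Π x : M, TangentSpace I x} {x : M}
    (hX : CMDiffAt ∞ (T% X) x) (hX' : CMDiffAt ∞ (T% X') x)
    (hY : CMDiffAt ∞ (T% Y) x) (hY' : CMDiffAt ∞ (T% Y') x)
    (hZ : CMDiffAt ∞ (T% Z) x) (hZ' : CMDiffAt ∞ (T% Z') x)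
    (hXX : X x = X' x) (hYY : Y x = Y' x) (hZZ : Z x = Z' x) :
    curvatureOperator (nabla I M) X Y Z x = curvatureOperator (nabla I M) X' Y' Z' x := by
  rw [curvature_congr_fst hX hX' hZ hXX, curvature_swap X' Y,
    curvature_congr_fst hY hY' hZ hYY, curvature_swap Y' X', neg_neg,
    curvature_congr_trd hX' hY' hZ hZ' hZZ]

end Connection

/-! ### Gradients of functions. -/

section Gradient

variable
  {E : Type*} [NormedAddCommGroup E] [NormedSpace ℝ E] [FiniteDimensional ℝ E] [CompleteSpace E]
  {H : Type*} [TopologicalSpace H] {I : ModelWithCorners ℝ E H}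
  {M : Type*} [TopologicalSpace M] [ChartedSpace H M] [IsManifold I ∞ M]
  [RiemannianBundle (fun x : M => TangentSpace I x)]

variable (I) in
/-- The gradient of a function on a Riemannian manifold. -/
def gradField (f : M → ℝ) : Π x : M, TangentSpace I x := fun x =>
  have : CompleteSpace (TangentSpace I x) := FiniteDimensional.complete ℝ _
  (InnerProductSpace.toDual ℝ (TangentSpace I x)).symm (mvfderiv I f x)

theorem inner_gradField (f : M → ℝ) (x : M) (v : TangentSpace I x) :
    inner ℝ (gradField I f x) v = mvfderiv I f x v := by
  have : CompleteSpace (TangentSpace I x) := FiniteDimensional.complete ℝ _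
  exact InnerProductSpace.toDual_symm_apply (𝕜 := ℝ) (E := TangentSpace I x)

variable [IsContMDiffRiemannianBundle I ∞ E (fun x : M => TangentSpace I x)]

theorem smooth_gradField {f : M → ℝ} {x : M} (hf : CMDiffAt ∞ f x) :
    CMDiffAt ∞ (T% (gradField I f)) x := by
  refine smooth_of_forall_inner fun W hW => ?_
  simp only [inner_gradField]
  exact contMDiffAt_mvfderiv_apply hf hW

end Gradient

/-! ### Smoothness of the vertical and horizontal projections; involutivity of the vertical
distribution. -/

section SubmersionFields

variable
  {E : Type*} [NormedAddCommGroup E] [NormedSpace ℝ E] [FiniteDimensional ℝ E] [CompleteSpace E]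
  {H : Type*} [TopologicalSpace H] (I : ModelWithCorners ℝ E H)
  {M : Type*} [TopologicalSpace M] [ChartedSpace H M] [IsManifold I ∞ M]
  {E' : Type*} [NormedAddCommGroup E'] [NormedSpace ℝ E'] [FiniteDimensional ℝ E']
  {H' : Type*} [TopologicalSpace H'] (J : ModelWithCorners ℝ E' H')
  {N : Type*} [TopologicalSpace N] [ChartedSpace H' N] [IsManifold J ∞ N]
  [RiemannianBundle (fun x : M => TangentSpace I x)]
  (F : M → N)

/-- The components of `F` in the preferred chart at `F p`. -/
def coordComponent (p : M) (k : Fin (Module.finrank ℝ E')) (y : M) : ℝ :=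
  (Module.finBasis ℝ E').coord k (extChartAt J (F p) (F y))

variable {I J F}

theorem smooth_coordComponent (hF : ContMDiff I J ∞ F) (p : M) (k : Fin (Module.finrank ℝ E')) :
    CMDiffAt ∞ (coordComponent J F p k) p := by
  have h1 : ContMDiffAt J 𝓘(ℝ, E') ∞ (extChartAt J (F p)) (F p) := contMDiffAt_extChartAt
  have h2 : ContMDiffAt I 𝓘(ℝ, E') ∞ (fun y => extChartAt J (F p) (F y)) p := h1.comp p (hF p)
  have h3 := (LinearMap.toContinuousLinearMap ((Module.finBasis ℝ E').coord k)).contMDiff (n := ∞)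
  exact (h3 _).comp p h2

theorem mvfderiv_coordComponent (hF : ContMDiff I J ∞ F) (p : M)
    (k : Fin (Module.finrank ℝ E')) {y : M} (hy : F y ∈ (chartAt H' (F p)).source)
    (v : TangentSpace I y) :
    mvfderiv I (coordComponent J F p k) y v
      = (Module.finBasis ℝ E').coord k
          (mfderiv J 𝓘(ℝ, E') (extChartAt J (F p)) (F y) (mfderiv I J F y v)) := by
  have h1 : IsManifold J 1 N := IsManifold.of_le (n := ∞) ENat.LEInfty.out
  have d1 : MDifferentiableAt J 𝓘(ℝ, E') (extChartAt J (F p)) (F y) :=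
    mdifferentiableAt_extChartAt hy
  have d2 : MDifferentiableAt I J F y := (hF y).mdifferentiableAt (by simp)
  let L : E' →L[ℝ] ℝ := LinearMap.toContinuousLinearMap ((Module.finBasis ℝ E').coord k)
  have d3 : MDifferentiableAt 𝓘(ℝ, E') 𝓘(ℝ, ℝ) L (extChartAt J (F p) (F y)) :=
    L.mdifferentiableAt
  have e : mfderiv I 𝓘(ℝ, ℝ) (L ∘ (extChartAt J (F p)) ∘ F) y
      = (mfderiv 𝓘(ℝ, E') 𝓘(ℝ, ℝ) L (extChartAt J (F p) (F y))).comp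
        ((mfderiv J 𝓘(ℝ, E') (extChartAt J (F p)) (F y)).comp (mfderiv I J F y)) := by
    rw [mfderiv_comp y d3 (d1.comp y d2), mfderiv_comp y d1 d2]
    rfl
  rw [ContinuousLinearMap.mfderiv_eq] at e
  exact congrArg (fun A => A v) e

variable (p : M)

/-- The differential of the chart is injective at every point of its domain, so the same functions
cut out the vertical spaces at all `y` near `p`. -/
theorem mem_vertical_iff_coordComponent (hF : ContMDiff I J ∞ F) {y : M}
    (hy : F y ∈ (chartAt H' (F p)).source) (v : TangentSpace I y) :
    v ∈ vertical I J F y ↔ ∀ k, mvfderiv I (coordComponent J F p k) y v = 0 := by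
  have h1 : IsManifold J 1 N := IsManifold.of_le (n := ∞) ENat.LEInfty.out
  simp only [mvfderiv_coordComponent hF p _ hy]
  constructor
  · intro hv k
    have : mfderiv I J F y v = 0 := hv
    rw [this, map_zero]
    exact map_zero _
  · intro h
    have h0 : mfderiv J 𝓘(ℝ, E') (extChartAt J (F p)) (F y) (mfderiv I J F y v) = 0 :=
      (Module.finBasis ℝ E').ext_elem fun k =>
        (h k).trans (map_zero ((Module.finBasis ℝ E').coord k)).symm
    have hinv := isInvertible_mfderiv_extChartAt (I := J) (x := F p) (y := F y)
      (by rwa [extChartAt_source])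
    exact hinv.injective (h0.trans (map_zero _).symm)

/-- The orthogonal complement of the gradients is the common kernel of the differentials, that is,
the vertical space; take complements once more. -/
theorem span_gradField_coordComponent (hF : ContMDiff I J ∞ F) {y : M}
    (hy : F y ∈ (chartAt H' (F p)).source) :
    Submodule.span ℝ (Set.range fun k => gradField I (coordComponent J F p k) y)
      = horizontal I J F y := by
  have h : vertical I J F y
      = (Submodule.span ℝ (Set.range fun k => gradField I (coordComponent J F p k) y))ᗮ := by
    ext v
    rw [mem_vertical_iff_coordComponent p hF hy, Submodule.mem_orthogonal]
    simp only [← inner_gradField]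
    constructor
    · intro hv u hu
      induction hu using Submodule.span_induction with
      | mem u hu => obtain ⟨k, rfl⟩ := hu; exact hv k
      | zero => simp
      | add a b _ _ ha hb => rw [inner_add_left, ha, hb, add_zero]
      | smul c a _ ha => rw [real_inner_smul_left, ha, mul_zero]
    · intro hv k
      exact hv _ (Submodule.subset_span ⟨k, rfl⟩)
  rw [horizontal, h, Submodule.orthogonal_orthogonal]

theorem linearIndependent_gradField_coordComponent (hF : ContMDiff I J ∞ F)
    (hs : ∀ p : M, Function.Surjective (mfderiv I J F p)) :
    LinearIndependent ℝ fun k => gradField I (coordComponent J F p k) p := by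
  have h1 : IsManifold J 1 N := IsManifold.of_le (n := ∞) ENat.LEInfty.out
  rw [Fintype.linearIndependent_iff]
  intro c hc i
  have hinv := isInvertible_mfderiv_extChartAt (I := J) (x := F p) (y := F p)
    (mem_extChartAt_source (F p))
  -- By surjectivity some `v` has the `i`-th basis vector as its image in coordinates; pairing the
  -- relation with `v` isolates `c i`.
  obtain ⟨w, hw⟩ := hinv.surjective (Module.finBasis ℝ E' i)
  obtain ⟨v, hv⟩ := hs p w
  have h0 : inner ℝ (∑ k, c k • gradField I (coordComponent J F p k) p) v = 0 := by
    rw [hc, inner_zero_left]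
  rw [sum_inner] at h0
  simp only [real_inner_smul_left, inner_gradField,
    mvfderiv_coordComponent hF p _ (mem_chart_source H' (F p)), hv, hw] at h0
  simpa [Finsupp.single_apply] using h0

theorem eventually_mem_chart_source (hF : ContMDiff I J ∞ F) :
    ∀ᶠ y in 𝓝 p, F y ∈ (chartAt H' (F p)).source :=
  hF.continuous.continuousAt.eventually_mem (chart_source_mem_nhds H' (F p))

variable {p}

theorem hPart_mem (X : Π x : M, TangentSpace I x) (y : M) :
    hPart I J F X y ∈ horizontal I J F y :=
  Submodule.starProjection_apply_mem _ _

theorem vPart_mem (X : Π x : M, TangentSpace I x) (y : M) :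
    vPart I J F X y ∈ vertical I J F y :=
  Submodule.starProjection_apply_mem _ _

theorem vPart_add_hPart (X : Π x : M, TangentSpace I x) :
    vPart I J F X + hPart I J F X = X := by
  funext y
  exact Submodule.starProjection_add_starProjection_orthogonal _

theorem inner_vertical_horizontal {y : M} {v w : TangentSpace I y} (hv : v ∈ vertical I J F y)
    (hw : w ∈ horizontal I J F y) : inner ℝ v w = 0 :=
  (Submodule.mem_orthogonal _ _).mp hw v hv

theorem inner_horizontal_vertical {y : M} {v w : TangentSpace I y} (hv : v ∈ vertical I J F y)
    (hw : w ∈ horizontal I J F y) : inner ℝ w v = 0 := by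
  rw [real_inner_comm]; exact inner_vertical_horizontal hv hw

variable [IsContMDiffRiemannianBundle I ∞ E (fun x : M => TangentSpace I x)]

/-- The gradients of the components of `F` are a smooth frame of the horizontal spaces near `p`, and
the horizontal part of `X` has the same inner products with them as `X` itself. -/
theorem smooth_hPart (hF : ContMDiff I J ∞ F)
    (hs : ∀ p : M, Function.Surjective (mfderiv I J F p)) {X : Π x : M, TangentSpace I x}
    (hX : CMDiffAt ∞ (T% X) p) : CMDiffAt ∞ (T% (hPart I J F X)) p := by
  have hg := fun k => smooth_gradField (smooth_coordComponent hF p k)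
  refine smooth_of_inner_smooth hg (linearIndependent_gradField_coordComponent p hF hs) ?_ ?_
  · filter_upwards [eventually_mem_chart_source p hF] with y hy
    rw [span_gradField_coordComponent p hF hy]
    exact hPart_mem X y
  · intro k
    refine (smooth_inner hX (hg k)).congr_of_eventuallyEq ?_
    filter_upwards [eventually_mem_chart_source p hF] with y hy
    have hmem : gradField I (coordComponent J F p k) y ∈ horizontal I J F y := by
      rw [← span_gradField_coordComponent p hF hy]
      exact Submodule.subset_span ⟨k, rfl⟩
    conv_rhs => rw [← congrFun (vPart_add_hPart (J := J) (F := F) X) y]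
    rw [Pi.add_apply, inner_add_left, inner_vertical_horizontal (vPart_mem X y) hmem, zero_add]

theorem smooth_vPart (hF : ContMDiff I J ∞ F)
    (hs : ∀ p : M, Function.Surjective (mfderiv I J F p)) {X : Π x : M, TangentSpace I x}
    (hX : CMDiffAt ∞ (T% X) p) : CMDiffAt ∞ (T% (vPart I J F X)) p := by
  have : vPart I J F X = X - hPart I J F X := by
    rw [eq_sub_iff_add_eq, vPart_add_hPart]
  rw [this]
  exact hX.sub_section (smooth_hPart hF hs hX)

/-- The bracket of vertical fields is vertical. -/
theorem mlieBracket_mem_vertical (hF : ContMDiff I J ∞ F) {X Y : Π x : M, TangentSpace I x}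
    (hX : CMDiffAt ∞ (T% X) p) (hY : CMDiffAt ∞ (T% Y) p)
    (hXv : ∀ y, X y ∈ vertical I J F y) (hYv : ∀ y, Y y ∈ vertical I J F y) :
    mlieBracket I X Y p ∈ vertical I J F p := by
  rw [mem_vertical_iff_coordComponent p hF (mem_chart_source H' (F p))]
  intro k
  -- A vertical field annihilates each component of `F` on a whole neighbourhood, so both iterated
  -- derivatives in the commutator vanish at `p`.
  have hz : ∀ {A : Π x : M, TangentSpace I x}, (∀ y, A y ∈ vertical I J F y) →
      (fun y => mvfderiv I (coordComponent J F p k) y (A y)) =ᶠ[𝓝 p] fun _ => (0 : ℝ) := by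
    intro A hA
    filter_upwards [eventually_mem_chart_source p hF] with y hy
    exact (mem_vertical_iff_coordComponent p hF hy (A y)).mp (hA y) k
  have hd : ∀ {A : Π x : M, TangentSpace I x}, (∀ y, A y ∈ vertical I J F y) →
      mvfderiv I (fun y => mvfderiv I (coordComponent J F p k) y (A y)) p = 0 := by
    intro A hA
    have e := (hz hA).mfderiv_eq (I := I) (I' := 𝓘(ℝ, ℝ))
    ext v
    exact congrArg (fun A => A v) (e.trans mfderiv_const)
  rw [mvfderiv_mlieBracket (smooth_coordComponent hF p k) hX hY, hd hYv, hd hXv]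
  simp

theorem nabla_sub_nabla {X Y : Π x : M, TangentSpace I x} {x : M}
    (hX : MDiffAt (T% X) x) (hY : MDiffAt (T% Y) x) :
    nabla I M X Y x - nabla I M Y X x = mlieBracket I X Y x :=
  (CovariantDerivative.torsion_eq_zero_iff _).mp leviCivita_torsion hX hY

end SubmersionFields

/-! ### O'Neill's tensor as second fundamental form, and the Gauss equation. -/

section Gauss

variable
  {E : Type*} [NormedAddCommGroup E] [NormedSpace ℝ E] [FiniteDimensional ℝ E] [CompleteSpace E]
  {H : Type*} [TopologicalSpace H] {I : ModelWithCorners ℝ E H}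
  {M : Type*} [TopologicalSpace M] [ChartedSpace H M] [IsManifold I ∞ M]
  {E' : Type*} [NormedAddCommGroup E'] [NormedSpace ℝ E'] [FiniteDimensional ℝ E']
  {H' : Type*} [TopologicalSpace H'] {J : ModelWithCorners ℝ E' H'}
  {N : Type*} [TopologicalSpace N] [ChartedSpace H' N] [IsManifold J ∞ N]
  [RiemannianBundle (fun x : M => TangentSpace I x)]
  [IsContMDiffRiemannianBundle I ∞ E (fun x : M => TangentSpace I x)]
  {F : M → N} {p : M}

variable (I J F) in
/-- The extension of a tangent vector to a vertical vector field (for a vertical vector). -/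
def vExt (u : TangentSpace I p) : Π x : M, TangentSpace I x :=
  vPart I J F (FiberBundle.extend E u)

theorem vExt_mem (u : TangentSpace I p) (y : M) : vExt I J F u y ∈ vertical I J F y :=
  vPart_mem _ y

theorem vExt_self {u : TangentSpace I p} (hu : u ∈ vertical I J F p) : vExt I J F u p = u := by
  simp only [vExt, vPart, FiberBundle.extend_apply_self]
  exact Submodule.starProjection_eq_self_iff.mpr hu

theorem smooth_vExt (hF : ContMDiff I J ∞ F)
    (hs : ∀ p : M, Function.Surjective (mfderiv I J F p)) (u : TangentSpace I p) :
    CMDiffAt ∞ (T% (vExt I J F u)) p :=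
  smooth_vPart hF hs (FiberBundle.contMDiffAt_extend ..)

theorem inner_vPart_vertical (X : Π x : M, TangentSpace I x) {y : M} {w : TangentSpace I y}
    (hw : w ∈ vertical I J F y) : (inner ℝ (vPart I J F X y) w : ℝ) = inner ℝ (X y) w := by
  conv_rhs => rw [← congrFun (vPart_add_hPart (J := J) (F := F) X) y]
  rw [Pi.add_apply, inner_add_left, inner_horizontal_vertical hw (hPart_mem X y), add_zero]

theorem inner_horizontal_hPart (X : Π x : M, TangentSpace I x) {y : M} {w : TangentSpace I y}
    (hw : w ∈ horizontal I J F y) : (inner ℝ w (hPart I J F X y) : ℝ) = inner ℝ w (X y) := by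
  conv_rhs => rw [← congrFun (vPart_add_hPart (J := J) (F := F) X) y]
  rw [Pi.add_apply, inner_add_right, inner_horizontal_vertical (vPart_mem X y) hw, zero_add]

/-- Metric compatibility for orthogonal fields. -/
theorem inner_nabla_of_orthogonal {X A B : Π x : M, TangentSpace I x}
    (hX : MDiffAt (T% X) p) (hA : MDiffAt (T% A) p) (hB : MDiffAt (T% B) p)
    (hAh : ∀ y, A y ∈ horizontal I J F y) (hBv : ∀ y, B y ∈ vertical I J F y) :
    inner ℝ (nabla I M X A p) (B p) = -inner ℝ (A p) (nabla I M X B p) := by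
  have h := leviCivita_metric hX hA hB
  have h0 : (fun y => (inner ℝ (A y) (B y) : ℝ)) = fun _ => 0 := by
    funext y
    exact inner_horizontal_vertical (hBv y) (hAh y)
  rw [h0, mvfderiv_const] at h
  simp only [zero_apply] at h
  simp only [nabla]
  linarith

/-- On vertical vectors O'Neill's tensor is the second fundamental form of the fibre. -/
theorem oneillTAt_of_vertical (hF : ContMDiff I J ∞ F)
    (hs : ∀ p : M, Function.Surjective (mfderiv I J F p)) (u : TangentSpace I p)
    {w : TangentSpace I p} (hw : w ∈ vertical I J F p) :
    oneillTAt I J F p u w = hPart I J F (nabla I M (vExt I J F u) (vExt I J F w)) p := by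
  -- The second summand of `T` vanishes because the horizontal part of the extension is zero at `p`:
  -- pair the summand with the vertical extension of its own value and move the derivative to that
  -- extension, which gives squared norm zero.
  have h0 : vPart I J F (nabla I M (vExt I J F u) (hPart I J F (FiberBundle.extend E w))) p = 0 := by
    set D := nabla I M (vExt I J F u) (hPart I J F (FiberBundle.extend E w)) with hD
    have hz := vPart_mem (I := I) (J := J) (F := F) D p
    have hA : hPart I J F (FiberBundle.extend E w) p = 0 := by
      have := congrFun (vPart_add_hPart (I := I) (J := J) (F := F) (FiberBundle.extend E w)) p
      rw [Pi.add_apply, FiberBundle.extend_apply_self] at this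
      have h1 : vPart I J F (FiberBundle.extend E w) p = w := vExt_self hw
      rw [h1] at this
      simpa using this
    have h2 := inner_nabla_of_orthogonal (J := J) (F := F)
      (smooth_mdiffAt (smooth_vExt hF hs u))
      (smooth_mdiffAt (smooth_hPart hF hs (FiberBundle.contMDiffAt_extend I E w)))
      (smooth_mdiffAt (smooth_vExt hF hs (vPart I J F D p))) (hPart_mem _) (vExt_mem _)
    rw [hA, inner_zero_left, neg_zero, vExt_self hz, ← hD, ← inner_vPart_vertical D hz] at h2
    exact inner_self_eq_zero.mp h2
  change hPart I J F (nabla I M (vExt I J F u) (vExt I J F w)) p + _ = _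
  exact (congrArg _ h0).trans (add_zero _)

theorem oneillTAt_mem_horizontal (hF : ContMDiff I J ∞ F)
    (hs : ∀ p : M, Function.Surjective (mfderiv I J F p)) (u : TangentSpace I p)
    {w : TangentSpace I p} (hw : w ∈ vertical I J F p) :
    oneillTAt I J F p u w ∈ horizontal I J F p := by
  rw [oneillTAt_of_vertical hF hs u hw]
  exact hPart_mem _ p

/-- By vanishing torsion the difference is the horizontal part of a bracket of vertical fields, and
that bracket is vertical. -/
theorem oneillTAt_comm (hF : ContMDiff I J ∞ F)
    (hs : ∀ p : M, Function.Surjective (mfderiv I J F p)) {u w : TangentSpace I p}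
    (hu : u ∈ vertical I J F p) (hw : w ∈ vertical I J F p) :
    oneillTAt I J F p u w = oneillTAt I J F p w u := by
  rw [oneillTAt_of_vertical hF hs u hw, oneillTAt_of_vertical hF hs w hu, ← sub_eq_zero]
  have su := smooth_vExt hF hs u
  have sw := smooth_vExt hF hs w
  have hv := mlieBracket_mem_vertical hF su sw (vExt_mem u) (vExt_mem w)
  simp only [hPart]
  rw [← map_sub, nabla_sub_nabla (smooth_mdiffAt su) (smooth_mdiffAt sw)]
  refine (Submodule.starProjection_apply_eq_zero_iff _).mpr ?_
  rw [horizontal, Submodule.orthogonal_orthogonal]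
  exact hv

/-- The connection sees only the value at `p` of the differentiating field. Linearity in the other
slot is inherited through symmetry. -/
theorem oneillTAt_linear_left (hF : ContMDiff I J ∞ F)
    (hs : ∀ p : M, Function.Surjective (mfderiv I J F p)) {u u' w : TangentSpace I p}
    (hu : u ∈ vertical I J F p) (hu' : u' ∈ vertical I J F p) (hw : w ∈ vertical I J F p)
    (a b : ℝ) : oneillTAt I J F p (a • u + b • u') w
      = a • oneillTAt I J F p u w + b • oneillTAt I J F p u' w := by
  have hsum : a • u + b • u' ∈ vertical I J F p :=
    Submodule.add_mem _ (Submodule.smul_mem _ _ hu) (Submodule.smul_mem _ _ hu')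
  simp only [oneillTAt_of_vertical hF hs _ hw, hPart, nabla]
  rw [vExt_self hsum, vExt_self hu, vExt_self hu']
  simp only [map_add, map_smul]

theorem oneillTAt_linear_right (hF : ContMDiff I J ∞ F)
    (hs : ∀ p : M, Function.Surjective (mfderiv I J F p)) {u u' w : TangentSpace I p}
    (hu : u ∈ vertical I J F p) (hu' : u' ∈ vertical I J F p) (hw : w ∈ vertical I J F p)
    (a b : ℝ) : oneillTAt I J F p w (a • u + b • u')
      = a • oneillTAt I J F p w u + b • oneillTAt I J F p w u' := by
  have hsum : a • u + b • u' ∈ vertical I J F p :=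
    Submodule.add_mem _ (Submodule.smul_mem _ _ hu) (Submodule.smul_mem _ _ hu')
  rw [oneillTAt_comm hF hs hw hsum, oneillTAt_comm hF hs hw hu, oneillTAt_comm hF hs hw hu',
    oneillTAt_linear_left hF hs hu hu' hw]

/-- One half of the Gauss equation. The vertical part of the inner derivative yields the iterated
fibre connection; for the horizontal part, metric compatibility moves the outer derivative onto `w`
and produces the product of two `T` terms. -/
theorem inner_nabla_nabla (hF : ContMDiff I J ∞ F)
    (hs : ∀ p : M, Function.Surjective (mfderiv I J F p)) (u v : TangentSpace I p)
    {w z : TangentSpace I p} (hw : w ∈ vertical I J F p) (hz : z ∈ vertical I J F p) :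
    inner ℝ (nabla I M (vExt I J F u) (nabla I M (vExt I J F v) (vExt I J F z)) p) w
      = inner ℝ (fibreNabla I J F (vExt I J F u)
          (fibreNabla I J F (vExt I J F v) (vExt I J F z)) p) w
        - inner ℝ (oneillTAt I J F p v z) (oneillTAt I J F p u w) := by
  have su := smooth_vExt hF hs u
  have sD := smooth_nabla (smooth_vExt hF hs v) (smooth_vExt hF hs z)
  set D := nabla I M (vExt I J F v) (vExt I J F z) with hD
  have sv := smooth_vPart hF hs sD
  have sh := smooth_hPart hF hs sD
  have e1 : nabla I M (vExt I J F u) D p = nabla I M (vExt I J F u) (vPart I J F D) p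
      + nabla I M (vExt I J F u) (hPart I J F D) p := by
    rw [← nabla_add_right _ (smooth_mdiffAt sv) (smooth_mdiffAt sh), vPart_add_hPart]
  have e2 := inner_nabla_of_orthogonal (J := J) (F := F) (smooth_mdiffAt su) (smooth_mdiffAt sh)
    (smooth_mdiffAt (smooth_vExt hF hs w)) (hPart_mem _) (vExt_mem _)
  rw [vExt_self hw, ← inner_horizontal_hPart _ (hPart_mem D p)] at e2
  rw [e1, inner_add_left, e2, oneillTAt_of_vertical hF hs u hw, oneillTAt_of_vertical hF hs v hz,
    fibreNabla, inner_vPart_vertical _ hw, fibreNabla, ← hD, sub_eq_add_neg]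

/-- The Gauss equation for the fibres of a submersion. -/
theorem gauss_equation (hF : ContMDiff I J ∞ F)
    (hs : ∀ p : M, Function.Surjective (mfderiv I J F p)) {u v w z : TangentSpace I p}
    (hu : u ∈ vertical I J F p) (hv : v ∈ vertical I J F p) (hw : w ∈ vertical I J F p)
    (hz : z ∈ vertical I J F p) :
    riemannTensor I p u v w z = fibreRiemannTensor I J F p u v w z
      + inner ℝ (oneillTAt I J F p u z) (oneillTAt I J F p v w)
      - inner ℝ (oneillTAt I J F p v z) (oneillTAt I J F p u w) := by
  have e : ∀ a : TangentSpace I p, CMDiffAt ∞ (T% (FiberBundle.extend E a)) p :=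
    fun a => FiberBundle.contMDiffAt_extend ..
  have hself : ∀ {a : TangentSpace I p}, a ∈ vertical I J F p →
      FiberBundle.extend E a p = vExt I J F a p := fun ha => by
    rw [FiberBundle.extend_apply_self, vExt_self ha]
  rw [riemannTensor, curvature_congr (e u) (smooth_vExt hF hs u) (e v) (smooth_vExt hF hs v)
    (e z) (smooth_vExt hF hs z) (hself hu) (hself hv) (hself hz)]
  change _ = inner ℝ (curvatureOperator (fibreNabla I J F) (vExt I J F u) (vExt I J F v)
    (vExt I J F z) p) w + _ - _
  simp only [curvatureOperator, Pi.sub_apply, inner_sub_left]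
  rw [inner_nabla_nabla hF hs u v hw hz, inner_nabla_nabla hF hs v u hw hz]
  -- The bracket term needs no correction: pairing with the vertical `w` ignores the projection.
  conv_rhs => rw [fibreNabla.eq_1 I J F (mlieBracket I _ _), inner_vPart_vertical _ hw]
  ring

end Gauss

/-! ### Chen's identity for a symmetric matrix. -/

section Algebra

/-- The defect in Chen's inequality for a symmetric matrix `t` with distinguished indices `0, 1`. -/
def chenDefect {k : ℕ} (t : Fin (k + 2) → Fin (k + 2) → ℝ) : ℝ :=
  (1 / 2 : ℝ) * ((t 0 0 + t 1 1 - (∑ i, t i i) / (k + 1)) ^ 2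
    + ∑ i : Fin k, (t i.succ.succ i.succ.succ - (∑ i, t i i) / (k + 1)) ^ 2
    + ∑ i : Fin k, 2 * (t 0 i.succ.succ ^ 2 + t 1 i.succ.succ ^ 2)
    + ∑ i : Fin k, ∑ j : Fin k, if i = j then 0 else t i.succ.succ j.succ.succ ^ 2)

/-- Here `k + 2` is r. The `k + 1` numbers `t 0 0 + t 1 1` and `t i i` for the remaining `i` have
sum tr t, and the variance identity for them supplies the constant. The entry `t 0 1` cancels, so
equality never constrains it. -/
theorem chen_identity {k : ℕ} (t : Fin (k + 2) → Fin (k + 2) → ℝ) (ht : ∀ i j, t i j = t j i) :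
    (1 / 2 : ℝ) * ∑ i, ∑ j, (t i i * t j j - t j i * t i j) - (t 0 0 * t 1 1 - t 1 0 * t 0 1)
      = (k : ℝ) / (2 * (k + 1)) * (∑ i, t i i) ^ 2 - chenDefect t := by
  have hk : (k : ℝ) + 1 ≠ 0 := by positivity
  have h1 : ∑ i, ∑ j, (t i i * t j j - t j i * t i j)
      = (∑ i, t i i) ^ 2 - ∑ i, ∑ j, t i j ^ 2 := by
    simp only [Finset.sum_sub_distrib]
    rw [sq, Finset.sum_mul_sum]
    congr 1
    exact Finset.sum_congr rfl fun i _ => Finset.sum_congr rfl fun j _ => by rw [ht j i, sq]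
  have h2 : ∑ i, ∑ j, t i j ^ 2 = t 0 0 ^ 2 + t 1 1 ^ 2 + 2 * t 0 1 ^ 2
      + ∑ i : Fin k, 2 * (t 0 i.succ.succ ^ 2 + t 1 i.succ.succ ^ 2)
      + ∑ i : Fin k, ∑ j : Fin k, t i.succ.succ j.succ.succ ^ 2 := by
    simp only [Fin.sum_univ_succ (n := k + 1), Fin.sum_univ_succ (n := k), Fin.succ_zero_eq_one,
      Finset.sum_add_distrib, ← Finset.mul_sum, ht (Fin.succ _) 0, ht (Fin.succ _) 1]
    ring
  have h3 : ∑ i : Fin k, ∑ j : Fin k, t i.succ.succ j.succ.succ ^ 2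
      = ∑ i : Fin k, t i.succ.succ i.succ.succ ^ 2
        + ∑ i : Fin k, ∑ j : Fin k, if i = j then 0 else t i.succ.succ j.succ.succ ^ 2 := by
    rw [← Finset.sum_add_distrib]
    refine Finset.sum_congr rfl fun i _ => ?_
    rw [← Finset.add_sum_erase _ _ (Finset.mem_univ i),
      ← Finset.add_sum_erase (f := fun j => if i = j then 0 else t i.succ.succ j.succ.succ ^ 2) _
        (Finset.mem_univ i), if_pos rfl, zero_add]
    congr 1
    refine Finset.sum_congr rfl fun j hj => ?_
    rw [if_neg (Finset.ne_of_mem_erase hj).symm]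
  have h4 : ∑ i, t i i = t 0 0 + t 1 1 + ∑ i : Fin k, t i.succ.succ i.succ.succ := by
    simp only [Fin.sum_univ_succ (n := k + 1), Fin.sum_univ_succ (n := k), Fin.succ_zero_eq_one]
    ring
  have h5 : ∀ μ : ℝ, ∑ i : Fin k, (t i.succ.succ i.succ.succ - μ) ^ 2
      = ∑ i : Fin k, t i.succ.succ i.succ.succ ^ 2
        - 2 * μ * ∑ i : Fin k, t i.succ.succ i.succ.succ + k * μ ^ 2 := by
    intro μ
    simp only [sub_sq, Finset.sum_add_distrib, Finset.sum_sub_distrib, Finset.mul_sum]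
    simp only [Finset.sum_const, Finset.card_univ, Fintype.card_fin, nsmul_eq_mul]
    congr 2
    exact Finset.sum_congr rfl fun i _ => by ring
  have h6 : ∑ i : Fin k, t i.succ.succ i.succ.succ = ∑ i, t i i - t 0 0 - t 1 1 := by
    rw [h4]; ring
  rw [chenDefect, h1, h2, h3, h5, h6, ht 1 0]
  generalize ∑ i, t i i = s
  field_simp
  ring

theorem chenDefect_nonneg {k : ℕ} (t : Fin (k + 2) → Fin (k + 2) → ℝ) : 0 ≤ chenDefect t := by
  have h : 0 ≤ ∑ i : Fin k, ∑ j : Fin k, if i = j then 0 else t i.succ.succ j.succ.succ ^ 2 :=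
    Finset.sum_nonneg fun i _ => Finset.sum_nonneg fun j _ => by split_ifs <;> positivity
  unfold chenDefect
  positivity

theorem chenDefect_eq_zero_iff {k : ℕ} (t : Fin (k + 2) → Fin (k + 2) → ℝ) :
    chenDefect t = 0 ↔ t 0 0 + t 1 1 = (∑ i, t i i) / (k + 1) ∧
      (∀ i : Fin k, t i.succ.succ i.succ.succ = (∑ i, t i i) / (k + 1)) ∧
      (∀ i : Fin k, t 0 i.succ.succ = 0 ∧ t 1 i.succ.succ = 0) ∧
      ∀ i j : Fin k, i ≠ j → t i.succ.succ j.succ.succ = 0 := by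
  have n4 : ∀ i : Fin k, 0 ≤ ∑ j : Fin k, if i = j then 0 else t i.succ.succ j.succ.succ ^ 2 :=
    fun i => Finset.sum_nonneg fun j _ => by split_ifs <;> positivity
  have n4' := Finset.sum_nonneg fun i (_ : i ∈ (Finset.univ : Finset (Fin k))) => n4 i
  rw [chenDefect, mul_eq_zero, or_iff_right (by norm_num),
    add_eq_zero_iff_of_nonneg (by positivity) n4', add_eq_zero_iff_of_nonneg (by positivity)
    (by positivity), add_eq_zero_iff_of_nonneg (by positivity) (by positivity),
    Finset.sum_eq_zero_iff_of_nonneg (fun i _ => n4 i),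
    Finset.sum_eq_zero_iff_of_nonneg (fun i _ => by positivity),
    Finset.sum_eq_zero_iff_of_nonneg (fun i _ => by positivity), sq_eq_zero_iff, sub_eq_zero,
    and_assoc, and_assoc]
  refine and_congr Iff.rfl (and_congr ?_ (and_congr ?_ ?_))
  · simp [sub_eq_zero]
  · refine forall_congr' fun i => ?_
    simp only [Finset.mem_univ, true_imp_iff, mul_eq_zero, OfNat.ofNat_ne_zero, false_or]
    rw [add_eq_zero_iff_of_nonneg (by positivity) (by positivity), sq_eq_zero_iff, sq_eq_zero_iff]
  · refine forall_congr' fun i => ?_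
    rw [Finset.sum_eq_zero_iff_of_nonneg (fun j _ => by split_ifs <;> positivity)]
    simp

/-- Rotation by θ turns the off-diagonal entry of the symmetric matrix with entries a, b, d into b
cos 2θ + ½ (d - a) sin 2θ. This vanishes when 2θ is the argument of (a - d) + 2bi; if that number is
zero, every angle works. -/
theorem exists_rotation (a b d : ℝ) : ∃ c s : ℝ, c ^ 2 + s ^ 2 = 1 ∧
    (c ^ 2 - s ^ 2) * b + c * s * (d - a) = 0 := by
  set z : ℂ := ⟨a - d, 2 * b⟩ with hz
  have hc : ‖z‖ * Real.cos z.arg = a - d := Complex.norm_mul_cos_arg z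
  have hs : ‖z‖ * Real.sin z.arg = 2 * b := Complex.norm_mul_sin_arg z
  have h1 : Real.cos z.arg = Real.cos (z.arg / 2) ^ 2 - Real.sin (z.arg / 2) ^ 2 := by
    rw [← Real.cos_two_mul']; ring_nf
  have h2 : Real.sin z.arg = 2 * Real.sin (z.arg / 2) * Real.cos (z.arg / 2) := by
    rw [← Real.sin_two_mul]; ring_nf
  refine ⟨Real.cos (z.arg / 2), Real.sin (z.arg / 2), Real.cos_sq_add_sin_sq _, ?_⟩
  rw [← h1]
  linear_combination (-1 / 2 : ℝ) * Real.cos z.arg * hs + (1 / 2 : ℝ) * Real.sin z.arg * hc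
    + (1 / 2 : ℝ) * (a - d) * h2

end Algebra

/-! ### Adapted orthonormal bases and rotation of a frame. -/

section Frames

variable {T : Type*} [NormedAddCommGroup T] [InnerProductSpace ℝ T]

theorem isOrthonormalBasisOf_coe {k : ℕ} {S : Submodule ℝ T} (b : OrthonormalBasis (Fin k) ℝ S) :
    IsOrthonormalBasisOf (fun i => (b i : T)) S := by
  refine ⟨b.orthonormal.comp_linearIsometry S.subtypeₗᵢ, ?_⟩
  have h : (Set.range fun i => (b i : T)) = S.subtype '' Set.range b := by
    rw [← Set.range_comp]; rfl
  have hb : Submodule.span ℝ (Set.range b) = ⊤ := by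
    simpa using b.toBasis.span_eq
  rw [h, Submodule.span_image, hb, Submodule.map_top, Submodule.range_subtype]

theorem exists_orthonormalBasisOf_line [FiniteDimensional ℝ T] {S : Submodule ℝ T} {m : ℕ}
    (hS : Module.finrank ℝ S = m) {w : T} (hw : w ∈ S) :
    ∃ h : Fin m → T, IsOrthonormalBasisOf h S ∧ ∀ l : Fin m, (l : ℕ) ≠ 0 → inner ℝ w (h l) = 0 := by
  by_cases hw0 : w = 0
  · subst hS hw0
    exact ⟨_, isOrthonormalBasisOf_coe (stdOrthonormalBasis ℝ S), fun l _ => inner_zero_left _⟩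
  let w' : S := ⟨w, hw⟩
  have hw' : w' ≠ 0 := fun h => hw0 (congrArg Subtype.val h)
  -- Only the entry at index 0 is prescribed to the extension theorem; the others are placeholders.
  let v : Fin m → S := fun _ => (‖w'‖⁻¹ : ℝ) • w'
  have hv : Orthonormal ℝ (({l : Fin m | (l : ℕ) = 0}).domRestrict v) := by
    refine ⟨fun i => ?_, fun i j hij => ?_⟩
    · change ‖(‖w'‖⁻¹ : ℝ) • w'‖ = 1
      rw [norm_smul, norm_inv, norm_norm, inv_mul_cancel₀ (norm_ne_zero_iff.mpr hw')]
    · exact absurd (Subtype.ext (Fin.ext (i.2.trans j.2.symm))) hij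
  obtain ⟨b, hb⟩ := hv.exists_orthonormalBasis_extension_of_card_eq (by simp [hS])
  refine ⟨_, isOrthonormalBasisOf_coe b, fun l hl => ?_⟩
  let z : Fin m := ⟨0, l.pos⟩
  have h0 : inner ℝ (b z) (b l) = 0 := b.orthonormal.2 fun h => hl (by rw [← h])
  rw [hb z rfl] at h0
  have h1 : (inner ℝ w' (b l) : ℝ) = 0 := by
    rw [real_inner_smul_left] at h0
    exact (mul_eq_zero.mp h0).resolve_left (inv_ne_zero (norm_ne_zero_iff.mpr hw'))
  exact h1

theorem exists_orthonormalBasisOf_plane [FiniteDimensional ℝ T] {S P : Submodule ℝ T} {r : ℕ}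
    (hS : Module.finrank ℝ S = r) (hr : 2 < r) (hP : P ≤ S) (hP2 : Module.finrank ℝ P = 2) :
    ∃ V : Fin r → T, IsOrthonormalBasisOf V S ∧
      Submodule.span ℝ {V (idx1 hr), V (idx2 hr)} = P := by
  let e : OrthonormalBasis (Fin 2) ℝ P := (stdOrthonormalBasis ℝ P).reindex (finCongr hP2)
  have he := isOrthonormalBasisOf_coe e
  -- Prescribed at indices 0 and 1 only; the later entries are placeholders.
  let v : Fin r → S := fun i => Submodule.inclusion hP (e (if (i : ℕ) = 0 then 0 else 1))
  have hv : Orthonormal ℝ (({l : Fin r | (l : ℕ) < 2}).domRestrict v) := by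
    have hinj : Function.Injective fun i : {l : Fin r | (l : ℕ) < 2} =>
        (if ((i : Fin r) : ℕ) = 0 then 0 else 1 : Fin 2) := by
      rintro ⟨i, hi⟩ ⟨j, hj⟩ hij
      simp only [Set.mem_ofPred_eq] at hi hj
      ext
      dsimp only at hij ⊢
      split_ifs at hij with h1 h2 <;> simp at hij <;> omega
    exact (e.orthonormal.comp _ hinj).comp_linearIsometry
      ⟨Submodule.inclusion hP, fun x => rfl⟩
  obtain ⟨b, hb⟩ := hv.exists_orthonormalBasis_extension_of_card_eq (by simp [hS])
  refine ⟨_, isOrthonormalBasisOf_coe b, ?_⟩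
  rw [hb (idx1 hr) (by simp [idx1]), hb (idx2 hr) (by simp [idx2])]
  conv_rhs => rw [← he.2]
  congr 1
  ext x
  simp [v, idx1, idx2, Fin.exists_fin_two, eq_comm]

theorem IsOrthonormalBasisOf.mem {k : ℕ} {V : Fin k → T} {S : Submodule ℝ T}
    (hV : IsOrthonormalBasisOf V S) (i : Fin k) : V i ∈ S :=
  hV.2 ▸ Submodule.subset_span ⟨i, rfl⟩

/-- Parseval's identity for an orthonormal basis of a subspace. -/
theorem IsOrthonormalBasisOf.inner_eq_sum {k : ℕ} {V : Fin k → T} {S : Submodule ℝ T}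
    (hV : IsOrthonormalBasisOf V S) (x : T) {y : T} (hy : y ∈ S) :
    inner ℝ x y = ∑ l, inner ℝ x (V l) * inner ℝ y (V l) := by
  rw [← hV.2] at hy
  obtain ⟨c, rfl⟩ := (Submodule.mem_span_range_iff_exists_fun ℝ).mp hy
  rw [inner_sum]
  refine Finset.sum_congr rfl fun l _ => ?_
  rw [real_inner_smul_right, hV.1.inner_left_fintype, mul_comm]
  simp

/-- Rotating the first two vectors of an orthonormal basis in their plane. -/
def rotateFrame {r : ℕ} (hr : 2 < r) (V : Fin r → T) (c s : ℝ) : Fin r → T := fun i =>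
  if i = idx1 hr then c • V (idx1 hr) + s • V (idx2 hr)
  else if i = idx2 hr then (-s) • V (idx1 hr) + c • V (idx2 hr) else V i

section rotateFrame

variable {r : ℕ} (hr : 2 < r) (V : Fin r → T) (c s : ℝ)

theorem idx2_ne_idx1 : idx2 hr ≠ idx1 hr := by simp [idx1, idx2]

theorem rotateFrame_idx1 : rotateFrame hr V c s (idx1 hr) = c • V (idx1 hr) + s • V (idx2 hr) := by
  simp [rotateFrame]

theorem rotateFrame_idx2 :
    rotateFrame hr V c s (idx2 hr) = (-s) • V (idx1 hr) + c • V (idx2 hr) := by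
  simp [rotateFrame, idx2_ne_idx1 hr]

theorem rotateFrame_of_ne {i : Fin r} (h1 : i ≠ idx1 hr) (h2 : i ≠ idx2 hr) :
    rotateFrame hr V c s i = V i := by
  simp [rotateFrame, h1, h2]

variable {c s}

/-- The inverse rotation turns each easy inclusion of spans into an equality. -/
theorem rotateFrame_rotateFrame (h : c ^ 2 + s ^ 2 = 1) :
    rotateFrame hr (rotateFrame hr V c s) c (-s) = V := by
  funext i
  by_cases h1 : i = idx1 hr
  · subst h1
    rw [rotateFrame_idx1, rotateFrame_idx1, rotateFrame_idx2]
    have : V (idx1 hr) = (c ^ 2 + s ^ 2) • V (idx1 hr) := by rw [h, one_smul]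
    conv_rhs => rw [this]
    module
  by_cases h2 : i = idx2 hr
  · subst h2
    rw [rotateFrame_idx2, rotateFrame_idx1, rotateFrame_idx2]
    have : V (idx2 hr) = (c ^ 2 + s ^ 2) • V (idx2 hr) := by rw [h, one_smul]
    conv_rhs => rw [this]
    module
  rw [rotateFrame_of_ne hr _ _ _ h1 h2, rotateFrame_of_ne hr _ _ _ h1 h2]

theorem span_rotateFrame_le (c s : ℝ) :
    Submodule.span ℝ (Set.range (rotateFrame hr V c s)) ≤ Submodule.span ℝ (Set.range V) := by
  rw [Submodule.span_le]
  rintro _ ⟨i, rfl⟩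
  have hm : ∀ j, V j ∈ Submodule.span ℝ (Set.range V) := fun j => Submodule.subset_span ⟨j, rfl⟩
  simp only [rotateFrame]
  split_ifs
  · exact Submodule.add_mem _ (Submodule.smul_mem _ _ (hm _)) (Submodule.smul_mem _ _ (hm _))
  · exact Submodule.add_mem _ (Submodule.smul_mem _ _ (hm _)) (Submodule.smul_mem _ _ (hm _))
  · exact hm i

theorem span_pair_rotateFrame_le (c s : ℝ) :
    Submodule.span ℝ {rotateFrame hr V c s (idx1 hr), rotateFrame hr V c s (idx2 hr)}
      ≤ Submodule.span ℝ {V (idx1 hr), V (idx2 hr)} := by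
  rw [Submodule.span_le]
  rintro x (rfl | rfl)
  · rw [rotateFrame_idx1]
    exact Submodule.mem_span_pair.mpr ⟨_, _, rfl⟩
  · rw [rotateFrame_idx2]
    exact Submodule.mem_span_pair.mpr ⟨_, _, rfl⟩

variable {V}

theorem span_pair_rotateFrame (h : c ^ 2 + s ^ 2 = 1) :
    Submodule.span ℝ {rotateFrame hr V c s (idx1 hr), rotateFrame hr V c s (idx2 hr)}
      = Submodule.span ℝ {V (idx1 hr), V (idx2 hr)} := by
  refine le_antisymm (span_pair_rotateFrame_le hr V c s) ?_
  have := span_pair_rotateFrame_le hr (rotateFrame hr V c s) c (-s)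
  rwa [rotateFrame_rotateFrame hr V h] at this

theorem IsOrthonormalBasisOf.rotateFrame {S : Submodule ℝ T} (hV : IsOrthonormalBasisOf V S)
    (h : c ^ 2 + s ^ 2 = 1) : IsOrthonormalBasisOf (rotateFrame hr V c s) S := by
  constructor
  · have hv := orthonormal_iff_ite.mp hV.1
    have h12 := (idx2_ne_idx1 hr).symm
    have h21 := idx2_ne_idx1 hr
    have tri : ∀ i : Fin r, i = idx1 hr ∨ i = idx2 hr ∨
        (SubmersionGeometry.rotateFrame hr V c s i = V i ∧ i ≠ idx1 hr ∧ i ≠ idx2 hr ∧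
          idx1 hr ≠ i ∧ idx2 hr ≠ i) := by
      intro i
      by_cases h1 : i = idx1 hr
      · exact Or.inl h1
      by_cases h2 : i = idx2 hr
      · exact Or.inr (Or.inl h2)
      exact Or.inr (Or.inr ⟨rotateFrame_of_ne hr V c s h1 h2, h1, h2, Ne.symm h1, Ne.symm h2⟩)
    rw [orthonormal_iff_ite]
    intro i j
    rcases tri i with rfl | rfl | hi <;> rcases tri j with rfl | rfl | hj <;> clear tri <;>
      simp only [*, rotateFrame_idx1, rotateFrame_idx2, inner_add_left, inner_add_right,
        real_inner_smul_left, real_inner_smul_right, if_true, if_false]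
    all_goals first | done | linarith
  · rw [← hV.2]
    refine le_antisymm (span_rotateFrame_le hr V c s) ?_
    have := span_rotateFrame_le hr (SubmersionGeometry.rotateFrame hr V c s) c (-s)
    rwa [rotateFrame_rotateFrame hr V h] at this

end rotateFrame

end Frames

/-! ### Chen's inequality with its defect, and the equality case. -/

section Chen

variable
  {E : Type*} [NormedAddCommGroup E] [NormedSpace ℝ E] [FiniteDimensional ℝ E] [CompleteSpace E]
  {H : Type*} [TopologicalSpace H] {I : ModelWithCorners ℝ E H}
  {M : Type*} [TopologicalSpace M] [ChartedSpace H M] [IsManifold I ∞ M]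
  {E' : Type*} [NormedAddCommGroup E'] [NormedSpace ℝ E'] [FiniteDimensional ℝ E']
  {H' : Type*} [TopologicalSpace H'] {J : ModelWithCorners ℝ E' H'}
  {N : Type*} [TopologicalSpace N] [ChartedSpace H' N] [IsManifold J ∞ N]
  [RiemannianBundle (fun x : M => TangentSpace I x)]
  [IsContMDiffRiemannianBundle I ∞ E (fun x : M => TangentSpace I x)]
  {F : M → N} {p : M}

theorem finrank_horizontal (hs : Function.Surjective (mfderiv I J F p)) :
    Module.finrank ℝ (horizontal I J F p) = Module.finrank ℝ E' := by
  have : FiniteDimensional ℝ (TangentSpace J (F p)) := inferInstanceAs (FiniteDimensional ℝ E')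
  have h1 := (vertical I J F p).finrank_add_finrank_orthogonal
  have h2 := LinearMap.finrank_range_add_finrank_ker
    (mfderiv I J F p : TangentSpace I p →ₗ[ℝ] TangentSpace J (F p))
  have h3 : LinearMap.range (mfderiv I J F p : TangentSpace I p →ₗ[ℝ] TangentSpace J (F p)) = ⊤ :=
    LinearMap.range_eq_top.mpr hs
  rw [h3, finrank_top] at h2
  change Module.finrank ℝ E' + Module.finrank ℝ (vertical I J F p) = _ at h2
  change _ + Module.finrank ℝ (horizontal I J F p) = _ at h1
  omega

theorem meanCurvature_mem_horizontal (hF : ContMDiff I J ∞ F)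
    (hs : ∀ p : M, Function.Surjective (mfderiv I J F p)) {r : ℕ} {V : Fin r → TangentSpace I p}
    (hV : IsOrthonormalBasisOf V (vertical I J F p)) :
    meanCurvature I J F p V ∈ horizontal I J F p :=
  Submodule.smul_mem _ _
    (Submodule.sum_mem _ fun i _ => oneillTAt_mem_horizontal hF hs _ (hV.mem i))

theorem inner_meanCurvature {r : ℕ} (V : Fin r → TangentSpace I p) (h : TangentSpace I p) :
    inner ℝ (meanCurvature I J F p V) h = (1 / (r : ℝ)) * ∑ i, tComp I J F p (V i) (V i) h := by
  rw [meanCurvature, real_inner_smul_left, sum_inner]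
  rfl

theorem tComp_comm (hF : ContMDiff I J ∞ F)
    (hs : ∀ p : M, Function.Surjective (mfderiv I J F p)) {u w : TangentSpace I p}
    (hu : u ∈ vertical I J F p) (hw : w ∈ vertical I J F p) (h : TangentSpace I p) :
    tComp I J F p u w h = tComp I J F p w u h := by
  rw [tComp, oneillTAt_comm hF hs hu hw, tComp]

/-- Parseval in the horizontal basis splits the Gauss correction by ℓ, so that the algebra applies
to one matrix at a time. -/
theorem fibreRiemannTensor_eq_sub_sum (hF : ContMDiff I J ∞ F)
    (hs : ∀ p : M, Function.Surjective (mfderiv I J F p)) {m : ℕ}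
    {h : Fin m → TangentSpace I p} (hh : IsOrthonormalBasisOf h (horizontal I J F p))
    {u v : TangentSpace I p} (hu : u ∈ vertical I J F p) (hv : v ∈ vertical I J F p) :
    fibreRiemannTensor I J F p u v v u = riemannTensor I p u v v u
      - ∑ l, (tComp I J F p u u (h l) * tComp I J F p v v (h l)
        - tComp I J F p v u (h l) * tComp I J F p u v (h l)) := by
  rw [gauss_equation hF hs hu hv hv hu,
    hh.inner_eq_sum (oneillTAt I J F p u u) (oneillTAt_mem_horizontal hF hs v hv),
    hh.inner_eq_sum (oneillTAt I J F p v u) (oneillTAt_mem_horizontal hF hs u hv),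
    Finset.sum_sub_distrib]
  simp only [tComp]
  ring

/-- The difference of the two sides of Chen's inequality is a sum of squares. -/
theorem chen_difference (hF : ContMDiff I J ∞ F)
    (hs : ∀ p : M, Function.Surjective (mfderiv I J F p)) {m k : ℕ} (hr : 2 < k + 2)
    {V : Fin (k + 2) → TangentSpace I p} (hV : IsOrthonormalBasisOf V (vertical I J F p))
    {h : Fin m → TangentSpace I p} (hh : IsOrthonormalBasisOf h (horizontal I J F p)) :
    scalarCurvature (fibreRiemannTensor I J F p) V - planeCurvature (fibreRiemannTensor I J F p) hr V
      = scalarCurvature (riemannTensor I p) V - planeCurvature (riemannTensor I p) hr V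
        - ((k + 2 : ℕ) : ℝ) ^ 2 * (((k + 2 : ℕ) : ℝ) - 2) / (2 * (((k + 2 : ℕ) : ℝ) - 1))
          * ‖meanCurvature I J F p V‖ ^ 2
        + ∑ l, chenDefect fun i j => tComp I J F p (V i) (V j) (h l) := by
  -- The trace of the ℓ-th matrix is r g(H, h_ℓ), and H is horizontal.
  have hnorm : (∑ l, (∑ i, tComp I J F p (V i) (V i) (h l)) ^ 2 : ℝ)
      = ((k : ℝ) + 2) ^ 2 * ‖meanCurvature I J F p V‖ ^ 2 := by
    have hk : (k : ℝ) + 2 ≠ 0 := by positivity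
    rw [← real_inner_self_eq_norm_sq,
      hh.inner_eq_sum _ (meanCurvature_mem_horizontal hF hs hV), Finset.mul_sum]
    refine Finset.sum_congr rfl fun l _ => ?_
    rw [inner_meanCurvature]
    push_cast
    field_simp
  have hid : ∑ l, ((1 / 2 : ℝ) * ∑ i, ∑ j,
        (tComp I J F p (V i) (V i) (h l) * tComp I J F p (V j) (V j) (h l)
          - tComp I J F p (V j) (V i) (h l) * tComp I J F p (V i) (V j) (h l))
        - (tComp I J F p (V 0) (V 0) (h l) * tComp I J F p (V 1) (V 1) (h l)
          - tComp I J F p (V 1) (V 0) (h l) * tComp I J F p (V 0) (V 1) (h l)))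
      = (k : ℝ) / (2 * (k + 1)) * (((k : ℝ) + 2) ^ 2 * ‖meanCurvature I J F p V‖ ^ 2)
        - ∑ l, chenDefect fun i j => tComp I J F p (V i) (V j) (h l) := by
    rw [← hnorm, Finset.mul_sum, ← Finset.sum_sub_distrib]
    exact Finset.sum_congr rfl fun l _ =>
      chen_identity (fun i j => tComp I J F p (V i) (V j) (h l))
        fun i j => tComp_comm hF hs (hV.mem i) (hV.mem j) _
  -- Move the sum over ℓ innermost, where the Gauss corrections of the individual pairs have it.
  rw [Finset.sum_sub_distrib, ← Finset.mul_sum, Finset.sum_comm] at hid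
  have hswap : ∀ i, ∑ l, ∑ j,
        (tComp I J F p (V i) (V i) (h l) * tComp I J F p (V j) (V j) (h l)
          - tComp I J F p (V j) (V i) (h l) * tComp I J F p (V i) (V j) (h l))
      = ∑ j, ∑ l, (tComp I J F p (V i) (V i) (h l) * tComp I J F p (V j) (V j) (h l)
          - tComp I J F p (V j) (V i) (h l) * tComp I J F p (V i) (V j) (h l)) :=
    fun i => Finset.sum_comm
  simp only [hswap] at hid
  have e1 : idx1 hr = 0 := rfl
  have e2 : idx2 hr = 1 := rfl
  simp only [scalarCurvature, planeCurvature, e1, e2,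
    fun i j => fibreRiemannTensor_eq_sub_sum hF hs hh (hV.mem i) (hV.mem j),
    Finset.sum_sub_distrib (f := fun _ => riemannTensor I p _ _ _ _)]
  simp only [Finset.sum_sub_distrib] at hid ⊢
  push_cast
  have hc : ((k : ℝ) + 2) ^ 2 * ((k : ℝ) + 2 - 2) / (2 * ((k : ℝ) + 2 - 1))
      * ‖meanCurvature I J F p V‖ ^ 2
      = (k : ℝ) / (2 * (k + 1)) * (((k : ℝ) + 2) ^ 2 * ‖meanCurvature I J F p V‖ ^ 2) := by
    have h1 : (k : ℝ) + 2 - 1 = k + 1 := by ring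
    rw [h1]
    have hk : (k : ℝ) + 1 ≠ 0 := by positivity
    field_simp
    ring
  rw [hc]
  linarith

theorem exists_eq_succ_succ {k : ℕ} {i : Fin (k + 2)} (hi : 2 ≤ (i : ℕ)) :
    ∃ j : Fin k, i = j.succ.succ :=
  ⟨⟨i - 2, by omega⟩, Fin.ext (by simp; omega)⟩

/-- A zero defect makes the `k + 1` numbers equal to tr t / (k + 1). For ℓ ≠ 0 the frame is
orthogonal to H, so this value is 0. For ℓ = 0 it is not prescribed, and mutual equality already
makes each number the mean. -/
theorem chenDefect_eq_zero_iff_equalityConditions {m k : ℕ} (hr : 2 < k + 2)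
    {V : Fin (k + 2) → TangentSpace I p} {h : Fin m → TangentSpace I p}
    (hh : IsHorizontalFrame I J F p V h) :
    (∀ l, (chenDefect fun i j => tComp I J F p (V i) (V j) (h l)) = 0)
      ↔ EqualityConditions I J F p hr V h := by
  have hk : (k : ℝ) + 1 ≠ 0 := by positivity
  have e1 : idx1 hr = 0 := rfl
  have e2 : idx2 hr = 1 := rfl
  have htr : ∀ l : Fin m, (l : ℕ) ≠ 0 → ∑ i, tComp I J F p (V i) (V i) (h l) = 0 := by
    intro l hl
    have := hh.2 l hl
    rw [inner_meanCurvature] at this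
    exact (mul_eq_zero.mp this).resolve_left (by positivity)
  simp only [chenDefect_eq_zero_iff]
  unfold EqualityConditions
  rw [e1, e2]
  have two_le : ∀ i : Fin k, 2 ≤ ((i.succ.succ : Fin (k + 2)) : ℕ) := fun i => by simp
  constructor
  · intro hz
    refine ⟨fun j l hj => ?_, fun i j l hi hj hij _ => ?_, fun i j l hi hj hl => ?_, fun l hl => ?_,
      fun i l hi _ => ?_⟩
    · obtain ⟨j, rfl⟩ := exists_eq_succ_succ hj
      exact (hz l).2.2.1 j
    · obtain ⟨i, rfl⟩ := exists_eq_succ_succ hi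
      obtain ⟨j, rfl⟩ := exists_eq_succ_succ hj
      exact (hz l).2.2.2 i j fun h => hij (by rw [h])
    · obtain ⟨i, rfl⟩ := exists_eq_succ_succ hi
      obtain ⟨j, rfl⟩ := exists_eq_succ_succ hj
      by_cases hij : i = j
      · subst hij
        rw [(hz l).2.1 i, htr l hl, zero_div]
      · exact (hz l).2.2.2 i j hij
    · rw [(hz l).1, htr l hl, zero_div]
    · obtain ⟨i, rfl⟩ := exists_eq_succ_succ hi
      rw [(hz l).1, (hz l).2.1 i]
  · rintro ⟨c1, c2, c3, c4, c5⟩ l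
    have hsum : ∑ i, tComp I J F p (V i) (V i) (h l)
        = tComp I J F p (V 0) (V 0) (h l) + tComp I J F p (V 1) (V 1) (h l)
          + ∑ i : Fin k, tComp I J F p (V i.succ.succ) (V i.succ.succ) (h l) := by
      simp only [Fin.sum_univ_succ (n := k + 1), Fin.sum_univ_succ (n := k), Fin.succ_zero_eq_one]
      ring
    have hcol := fun j : Fin k => c1 j.succ.succ l (two_le j)
    by_cases hl : (l : ℕ) = 0
    · have hd := fun i : Fin k => c5 i.succ.succ l (two_le i) hl
      have hμ : (∑ i, tComp I J F p (V i) (V i) (h l)) / ((k : ℝ) + 1)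
          = tComp I J F p (V 0) (V 0) (h l) + tComp I J F p (V 1) (V 1) (h l) := by
        rw [hsum]
        simp only [← hd, Finset.sum_const, Finset.card_univ, Fintype.card_fin, nsmul_eq_mul]
        field_simp
        ring
      exact ⟨hμ.symm, fun i => by rw [hμ, hd i], hcol, fun i j hij =>
        c2 _ _ l (two_le i) (two_le j) (fun h => hij (by simpa using h)) hl⟩
    · rw [htr l hl, zero_div]
      exact ⟨c4 l hl, fun i => c3 _ _ l (two_le i) (two_le i) hl, hcol,
        fun i j _ => c3 _ _ l (two_le i) (two_le j) hl⟩

theorem exists_horizontalFrame (hF : ContMDiff I J ∞ F)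
    (hs : ∀ p : M, Function.Surjective (mfderiv I J F p)) {r : ℕ} {V : Fin r → TangentSpace I p}
    (hV : IsOrthonormalBasisOf V (vertical I J F p)) :
    ∃ h : Fin (Module.finrank ℝ E') → TangentSpace I p, IsHorizontalFrame I J F p V h :=
  exists_orthonormalBasisOf_line (finrank_horizontal (hs p))
    (meanCurvature_mem_horizontal hF hs hV)

/-- The plane of a vertical frame has an orthonormal basis diagonalizing the component of O'Neill's
tensor along a given vector. -/
theorem exists_verticalFrame_tComp_eq_zero (hF : ContMDiff I J ∞ F)
    (hs : ∀ p : M, Function.Surjective (mfderiv I J F p)) {r : ℕ} (hr : 2 < r)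
    {P : Submodule ℝ (TangentSpace I p)} {V : Fin r → TangentSpace I p}
    (hV : IsVerticalFrame I J F p hr P V) (h : TangentSpace I p) :
    ∃ V' : Fin r → TangentSpace I p, IsVerticalFrame I J F p hr P V' ∧
      (∀ i : Fin r, 2 ≤ (i : ℕ) → V' i = V i) ∧
      tComp I J F p (V' (idx1 hr)) (V' (idx2 hr)) h = 0 ∧
      tComp I J F p (V' (idx2 hr)) (V' (idx1 hr)) h = 0 := by
  obtain ⟨c, s, hcs, hrot⟩ := exists_rotation (tComp I J F p (V (idx1 hr)) (V (idx1 hr)) h)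
    (tComp I J F p (V (idx1 hr)) (V (idx2 hr)) h) (tComp I J F p (V (idx2 hr)) (V (idx2 hr)) h)
  have hV' := hV.1.rotateFrame hr hcs
  have m1 := hV.1.mem (idx1 hr)
  have m2 := hV.1.mem (idx2 hr)
  have m1' := hV'.mem (idx1 hr)
  have m2' := hV'.mem (idx2 hr)
  have key : tComp I J F p (rotateFrame hr V c s (idx1 hr)) (rotateFrame hr V c s (idx2 hr)) h
      = 0 := by
    have hcomm := tComp_comm hF hs m2 m1 h
    rw [tComp, rotateFrame_idx1, oneillTAt_linear_left hF hs m1 m2 m2', rotateFrame_idx2,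
      oneillTAt_linear_right hF hs m1 m2 m1, oneillTAt_linear_right hF hs m1 m2 m2]
    simp only [inner_add_left, real_inner_smul_left]
    simp only [tComp] at hrot hcomm
    linear_combination hrot - s ^ 2 * hcomm
  refine ⟨rotateFrame hr V c s, ⟨hV', ?_⟩, fun i hi => ?_, key, ?_⟩
  · rw [span_pair_rotateFrame hr hcs, hV.2]
  · refine rotateFrame_of_ne hr V c s ?_ ?_ <;> rintro rfl <;> simp [idx1, idx2] at hi
  · rw [tComp_comm hF hs m2' m1', key]

end Chen

end SubmersionGeometry

end

/-! ### The theorem. -/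

theorem theorem1 {n m r : ℕ}
    {M₁ : Type*} [TopologicalSpace M₁] [T2Space M₁] [SecondCountableTopology M₁]
    [ChartedSpace (EuclideanSpace ℝ (Fin n)) M₁] [IsManifold (𝓡 n) ∞ M₁]
    [RiemannianBundle (fun x : M₁ => TangentSpace (𝓡 n) x)]
    [IsContMDiffRiemannianBundle (𝓡 n) ∞ (EuclideanSpace ℝ (Fin n))
      (fun x : M₁ => TangentSpace (𝓡 n) x)]
    {M₂ : Type*} [TopologicalSpace M₂] [T2Space M₂] [SecondCountableTopology M₂]
    [ChartedSpace (EuclideanSpace ℝ (Fin m)) M₂] [IsManifold (𝓡 m) ∞ M₂]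
    [RiemannianBundle (fun y : M₂ => TangentSpace (𝓡 m) y)]
    [IsContMDiffRiemannianBundle (𝓡 m) ∞ (EuclideanSpace ℝ (Fin m))
      (fun y : M₂ => TangentSpace (𝓡 m) y)]
    (F : M₁ → M₂) (hF : IsRiemannianSubmersion (𝓡 n) (𝓡 m) F) (p : M₁)
    (hdim : Module.finrank ℝ (vertical (𝓡 n) (𝓡 m) F p) = r) (hr : 2 < r)
    (P : Submodule ℝ (TangentSpace (𝓡 n) p)) (hP : P ≤ vertical (𝓡 n) (𝓡 m) F p)
    (hPdim : Module.finrank ℝ P = 2) :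
    (∃ (V : Fin r → TangentSpace (𝓡 n) p) (h : Fin m → TangentSpace (𝓡 n) p),
      IsVerticalFrame (𝓡 n) (𝓡 m) F p hr P V ∧ IsHorizontalFrame (𝓡 n) (𝓡 m) F p V h) ∧
    ∀ V : Fin r → TangentSpace (𝓡 n) p, IsVerticalFrame (𝓡 n) (𝓡 m) F p hr P V →
      (scalarCurvature (fibreRiemannTensor (𝓡 n) (𝓡 m) F p) V
            - planeCurvature (fibreRiemannTensor (𝓡 n) (𝓡 m) F p) hr V
          ≥ scalarCurvature (riemannTensor (𝓡 n) p) V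
            - planeCurvature (riemannTensor (𝓡 n) p) hr V
            - (r : ℝ) ^ 2 * ((r : ℝ) - 2) / (2 * ((r : ℝ) - 1))
              * ‖meanCurvature (𝓡 n) (𝓡 m) F p V‖ ^ 2) ∧
      ∀ h : Fin m → TangentSpace (𝓡 n) p, IsHorizontalFrame (𝓡 n) (𝓡 m) F p V h →
        ((scalarCurvature (fibreRiemannTensor (𝓡 n) (𝓡 m) F p) V
              - planeCurvature (fibreRiemannTensor (𝓡 n) (𝓡 m) F p) hr V
            = scalarCurvature (riemannTensor (𝓡 n) p) V
              - planeCurvature (riemannTensor (𝓡 n) p) hr V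
              - (r : ℝ) ^ 2 * ((r : ℝ) - 2) / (2 * ((r : ℝ) - 1))
                * ‖meanCurvature (𝓡 n) (𝓡 m) F p V‖ ^ 2)
          ↔ EqualityConditions (𝓡 n) (𝓡 m) F p hr V h) ∧
        ∃ V' : Fin r → TangentSpace (𝓡 n) p, IsVerticalFrame (𝓡 n) (𝓡 m) F p hr P V' ∧
          (∀ i : Fin r, 2 ≤ (i : ℕ) → V' i = V i) ∧
          ∀ l : Fin m, (l : ℕ) = 0 →
            tComp (𝓡 n) (𝓡 m) F p (V' (idx1 hr)) (V' (idx2 hr)) (h l) = 0 ∧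
            tComp (𝓡 n) (𝓡 m) F p (V' (idx2 hr)) (V' (idx1 hr)) (h l) = 0 := by

  have hs := hF.mfderiv_surjective
  have hm : Module.finrank ℝ (EuclideanSpace ℝ (Fin m)) = m := by simp
  have hframe : ∀ V : Fin r → TangentSpace (𝓡 n) p, IsVerticalFrame (𝓡 n) (𝓡 m) F p hr P V →
      ∃ h : Fin m → TangentSpace (𝓡 n) p, IsHorizontalFrame (𝓡 n) (𝓡 m) F p V h := by
    intro V hV
    have := exists_horizontalFrame hF.smooth hs hV.1
    rwa [hm] at this
  refine ⟨?_, fun V hV => ⟨?_, fun h hh => ⟨?_, ?_⟩⟩⟩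
  · obtain ⟨V, hV⟩ := exists_orthonormalBasisOf_plane hdim hr hP hPdim
    obtain ⟨h, hh⟩ := hframe V hV
    exact ⟨V, h, hV, hh⟩
  -- The inequality mentions no horizontal frame, but its proof expands along one.
  · obtain ⟨h, hh⟩ := hframe V hV
    obtain ⟨k, rfl⟩ : ∃ k, r = k + 2 := ⟨r - 2, by omega⟩
    rw [chen_difference hF.smooth hs hr hV.1 hh.1]
    exact le_add_of_nonneg_right (Finset.sum_nonneg fun l _ => chenDefect_nonneg _)
  · obtain ⟨k, rfl⟩ : ∃ k, r = k + 2 := ⟨r - 2, by omega⟩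
    rw [chen_difference hF.smooth hs hr hV.1 hh.1, add_eq_left,
      Finset.sum_eq_zero_iff_of_nonneg fun l _ => chenDefect_nonneg _,
      ← chenDefect_eq_zero_iff_equalityConditions hr hh]
    simp
  -- With no horizontal direction there is no h_1, and `V` itself serves.
  · rcases Nat.eq_zero_or_pos m with rfl | hm0
    · exact ⟨V, hV, fun _ _ => rfl, fun l => l.elim0⟩
    · obtain ⟨V', hV', hV'V, h0⟩ :=
        exists_verticalFrame_tComp_eq_zero hF.smooth hs hr hV (h ⟨0, hm0⟩)
      refine ⟨V', hV', hV'V, fun l hl => ?_⟩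
      obtain rfl : l = ⟨0, hm0⟩ := Fin.ext hl
      exact h0
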